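/- Let $n\ge 1$ and write $(z,w)$ for the coordinates of $\mathbb C^{n+1}$, $z=(z_1,\dots,z_n)$, $w=u+iv$. Let $P_1,\dots,P_k$ be holomorphic polynomials in $z$, homogeneous of the same degree $d\ge 1$, put $Q(z,\bar z)=\sum_{l=1}^k P_l(z)\overline{P_l(z)}$ and $m=2d$, and assume $Q\not\equiv 0$. Suppose that the model hypersurface $M_0=\{(z,w)\in\mathbb C^{n+1} : v=Q(z,\bar z)\}$ is holomorphically nondegenerate at $0$, i.e. the only germ at $0$ of a holomorphic vector field $X=\sum_j X_j(z,w)\,\partial_{z_j}+X_0(z,w)\,\partial_w$ tangent to $M_0$ (that is, $X(v-Q)=0$ on $M_0$ near $0$) is $X=0$. Let $M\subset\mathbb C^{n+1}$ be any smooth perturbation of $M_0$, i.e. a hypersurface given near $0$ by $v=\psi(z,\bar z,u)$, where $\psi$ is a real-valued $C^\infty$ function near $0$ such that all derivatives $$\frac{\partial^{|\alpha|+|\beta|+l}(\psi-Q)}{\partial z^{\alpha}\,\partial\bar z^{\beta}\,\partial u^{l}}(0),\qquad l+\frac{|\alpha|+|\beta|}{m}\le 1,$$ vanish. Let $\mathrm{Aut}(M,0)$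 be the set of germs at $0$ of biholomorphisms of $\mathbb C^{n+1}$ that fix $0$ and map $M$ into itself. Then every element of $\mathrm{Aut}(M,0)$ is uniquely determined by its $2$-jet at $0$: if $F,G\in\mathrm{Aut}(M,0)$ have the same partial derivatives at $0$ of all orders $\le 2$, then $F=G$ as germs at $0$. -/

import Mathlib

open Filter Topology
open scoped ContDiff

namespace CRModel

/-- The space `ℂⁿ⁺¹` with coordinates `(z, w)`, where `z ∈ ℂⁿ` and `w = u + iv ∈ ℂ`.
(The choice of a norm plays no role: only germs, derivatives and analyticity are used.) -/
abbrev Cn1 (n : ℕ) : Type := (Fin n → ℂ) × ℂ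

/-- The sum of squares `Q(z, z̄) = ∑ₗ Pₗ(z) \overline{Pₗ(z)}`, as a real-valued function of `z`. -/
noncomputable def sumOfSquares {n k : ℕ} (P : Fin k → MvPolynomial (Fin n) ℂ)
    (z : Fin n → ℂ) : ℝ :=
  ∑ l, ‖MvPolynomial.eval z (P l)‖ ^ 2

/-- The defining function `v - Q(z, z̄)` of the model hypersurface `v = Q(z, z̄)`. -/
def modelDefiningFunction {n : ℕ} (Q : (Fin n → ℂ) → ℝ) (p : Cn1 n) : ℝ :=
  p.2.im - Q p.1

/-- `X` is (a representative of) a germ at `p` of a holomorphic vector field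
`∑ⱼ X_j ∂_{z_j} + X_w ∂_w` that is tangent to the hypersurface `{ρ = 0}`, i.e. `X ρ = 0` on
`{ρ = 0}` near `p`. A `(1,0)`-field `X` satisfies `X ρ = 0` at `q` exactly when the real
directional derivatives of `ρ` at `q` along the vectors `X(q)` and `i X(q)` both vanish. -/
def IsTangentHolomorphicField {n : ℕ} (ρ : Cn1 n → ℝ) (p : Cn1 n) (X : Cn1 n → Cn1 n) : Prop :=
  AnalyticAt ℂ X p ∧
    ∀ᶠ q in 𝓝 p, ρ q = 0 →
      fderiv ℝ ρ q (X q) = 0 ∧ fderiv ℝ ρ q (Complex.I • X q) = 0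

/-- The hypersurface `{ρ = 0}` is holomorphically nondegenerate at `p`: there is no nonzero germ
at `p` of a holomorphic vector field tangent to it. -/
def HolomorphicallyNondegenerateAt {n : ℕ} (ρ : Cn1 n → ℝ) (p : Cn1 n) : Prop :=
  ∀ X : Cn1 n → Cn1 n, IsTangentHolomorphicField ρ p X → X =ᶠ[𝓝 p] 0

/-- All derivatives at `0` of `r(z, z̄, u)` of weighted order at most one vanish, where `z` has
weight `1/m` and `u` has weight `1`: a derivative taken `j` times in (real) directions of the
`z`-space and `l` times in `u` has weighted order `l + j/m`. (For a smooth function, the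
derivatives `∂_z^α ∂_{z̄}^β` with `|α| + |β| = j` and the `j`-fold real directional derivatives
in the `z`-space span the same space.) -/
def WeightedDerivativesVanish {n : ℕ} (m : ℕ) (r : (Fin n → ℂ) × ℝ → ℝ) : Prop :=
  ∀ j l : ℕ, (l : ℚ) + (j : ℚ) / (m : ℚ) ≤ 1 →
    ∀ v : Fin j → (Fin n → ℂ),
      iteratedFDeriv ℝ (j + l) r 0
        (Fin.append (fun i => ((v i, 0) : (Fin n → ℂ) × ℝ)) (fun _ => (0, 1))) = 0

/-- `M` is a smooth perturbation of the model `v = Q(z, z̄)`, with `Q` homogeneous of degree `m`: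
near `0`, `M` is the graph `v = ψ(z, z̄, u)` of a smooth real-valued `ψ = Q + o(1)`, where `o(1)`
is a smooth function whose derivatives at `0` of weighted order at most one vanish. -/
def IsSmoothPerturbation {n : ℕ} (m : ℕ) (Q : (Fin n → ℂ) → ℝ) (M : Set (Cn1 n)) : Prop :=
  ∃ ψ : (Fin n → ℂ) × ℝ → ℝ,
    (∃ U : Set ((Fin n → ℂ) × ℝ), IsOpen U ∧ (0 : (Fin n → ℂ) × ℝ) ∈ U ∧ ContDiffOn ℝ ∞ ψ U) ∧
    WeightedDerivativesVanish m (fun x => ψ x - Q x.1) ∧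
    ∀ᶠ p : Cn1 n in 𝓝 0, p ∈ M ↔ p.2.im = ψ (p.1, p.2.re)

/-- `F` represents an element of the stability group `Aut(M, 0)`: a germ at `0` of a
biholomorphism fixing `0` and mapping `M` into itself. -/
def IsLocalAutomorphism {n : ℕ} (M : Set (Cn1 n)) (F : Cn1 n → Cn1 n) : Prop :=
  AnalyticAt ℂ F 0 ∧ F 0 = 0 ∧
    (∃ G : Cn1 n → Cn1 n, AnalyticAt ℂ G 0 ∧ G 0 = 0 ∧
      (∀ᶠ p in 𝓝 0, G (F p) = p) ∧ (∀ᶠ p in 𝓝 0, F (G p) = p)) ∧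
    ∀ᶠ p in 𝓝 0, p ∈ M → F p ∈ M

/-- `F` and `G` have the same `k`-jet at `p`: their holomorphic derivatives at `p` of all orders
at most `k` coincide. -/
def SameJet {n : ℕ} (k : ℕ) (F G : Cn1 n → Cn1 n) (p : Cn1 n) : Prop :=
  ∀ i ≤ k, iteratedFDeriv ℂ i F p = iteratedFDeriv ℂ i G p

end CRModel

/-!
If `F` and `G` have the same `2`-jet, then `K = F⁻¹ ∘ G - id` is `O(‖p‖³)`. Give `z` weight `1` and
`w` weight `m = 2d`: the first nonzero weighted component of `K` is an infinitesimal automorphism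
`X = (f, g)` of the model, still vanishing to third order at `0`, because `ψ - Q` only contributes
terms of higher weight. Polarizing the tangency equation gives a holomorphic identity in
`(z, w, η, τ)` with `z` and `η` independent. Scaling `(z, η)` to `(t z, t̄⁻¹ η)` keeps `⟪P η, P z⟫`
fixed, so Liouville's theorem applies in `t`; together with the third-order vanishing it shows that
`g = 0` and that `f` annihilates every `Pₗ`. Such a field is tangent to the model, hence zero by
holomorphic nondegeneracy.
-/

namespace CRModel

open Asymptotics Complex ComplexConjugate Set
open scoped InnerProductSpace

section Polarization

variable {W : Type*} [AddCommGroup W] [Module ℂ W]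
  {E : Type*} [NormedAddCommGroup E] [InnerProductSpace ℂ E]

lemma eq_zero_of_forall_ofReal {Θ : ℂ → ℂ} (hΘ : Differentiable ℂ Θ) (h : ∀ x : ℝ, Θ x = 0) :
    Θ = 0 := by
  have hfreq : Tendsto ((↑) : ℝ → ℂ) (𝓝[≠] 0) (𝓝[≠] 0) := by
    refine tendsto_nhdsWithin_iff.2 ⟨?_, ?_⟩
    · exact (continuous_ofReal.tendsto' 0 0 ofReal_zero).mono_left nhdsWithin_le_nhds
    · filter_upwards [self_mem_nhdsWithin] with x hx using ofReal_ne_zero.2 hx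
  exact AnalyticOnNhd.eq_of_frequently_eq (z₀ := 0) (fun x _ => hΘ.analyticAt x)
    (fun _ _ => analyticAt_const) (hfreq.frequently (Frequently.of_forall h))

lemma differentiable_conj_comp_conj {φ : ℂ → ℂ} (hφ : Differentiable ℂ φ) :
    Differentiable ℂ fun c => conj (φ (conj c)) :=
  fun c => differentiableAt_conj_conj_iff.2 (hφ (conj c))

lemma differentiable_inner_comp_conj {a b : ℂ → E} (ha : Differentiable ℂ a)
    (hb : Differentiable ℂ b) : Differentiable ℂ fun c => ⟪a (conj c), b c⟫_ℂ := by
  intro c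
  have ha' : HasFDerivAt (fun c => a (conj c)) _ c :=
    ((ha (conj c)).hasFDerivAt.restrictScalars ℝ).comp c conjCLE.hasFDerivAt
  have hb' : HasFDerivAt b _ c := (hb c).hasFDerivAt.restrictScalars ℝ
  have hab := ha'.inner ℂ hb'
  refine (hasFDerivAt_of_restrictScalars ℝ hab
    (f' := ContinuousLinearMap.toSpanSingleton ℂ
      (⟪deriv a (conj c), b c⟫_ℂ + ⟪a (conj c), deriv b c⟫_ℂ)) ?_).differentiableAt
  ext s
  simp [inner_smul_left, inner_smul_right, mul_add, add_comm]

/-- Holomorphy of `G x y` in `x` and antiholomorphy in `y`, in the form in which it is used: along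
the anti-diagonal complex lines `c ↦ (x + c v, y + c̄ w)`. -/
def IsSesquiholomorphic (G : W → W → ℂ) : Prop :=
  ∀ x y v w : W, Differentiable ℂ fun c : ℂ => G (x + c • v) (y + conj c • w)

theorem IsSesquiholomorphic.eq_conj_swap {G : W → W → ℂ} (hG : IsSesquiholomorphic G)
    (hreal : ∀ x, (G x x).im = 0) (x y : W) : G x y = conj (G y x) := by
  -- The line `c ↦ (γ c, γ c̄)` is diagonal at real `c` and passes through `(x, y)` at `c = I`.
  let γ : ℂ → W := fun c => (2⁻¹ : ℂ) • (x + y) + c • (-(I / 2)) • (x - y)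
  have hx : γ I = x := by linear_combination (norm := module) I_sq • ((-1 / 2 : ℂ) • (x - y))
  have hy : γ (-I) = y := by linear_combination (norm := module) I_sq • ((1 / 2 : ℂ) • (x - y))
  let H : ℂ → ℂ := fun c => G (γ c) (γ (conj c))
  have hH : Differentiable ℂ H := hG _ _ _ _
  have hΘ := eq_zero_of_forall_ofReal (hH.sub (differentiable_conj_comp_conj hH)) fun s => by
    simp [H, conj_ofReal, sub_conj, hreal]
  simpa [H, hx, hy, sub_eq_zero] using congrFun hΘ I

end Polarization

section Rigidity

variable {V : Type*} [NormedAddCommGroup V] [NormedSpace ℂ V]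
  {E : Type*} [NormedAddCommGroup E] [InnerProductSpace ℂ E]
  {p : V → E} {X : V × ℂ → V × ℂ} {d : ℕ}

/-- For the hypersurface `Im w = ‖p z‖²` and a holomorphic field `X = (f, g)`, the derivative of the
defining function along `2 Re X`, up to a constant and with the conjugated variable `z̄` replaced by
the independent variable `η̄`. -/
noncomputable def tangencyForm (p : V → E) (X : V × ℂ → V × ℂ) (η : V) (x : V × ℂ) : ℂ :=
  (X x).2 - 2 * I * ⟪p η, fderiv ℂ p x.1 (X x).1⟫_ℂ

/-- The real part of the field `X` is tangent to the hypersurface `Im w = ‖p z‖²`. -/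
def IsInfinitesimalAutomorphism (p : V → E) (X : V × ℂ → V × ℂ) : Prop :=
  ∀ (z : V) (u : ℝ), (tangencyForm p X z (z, u + I * ‖p z‖ ^ 2)).im = 0

theorem IsInfinitesimalAutomorphism.tangencyForm_eq_conj [CompleteSpace E]
    (hX : IsInfinitesimalAutomorphism p X) (hp : AnalyticOnNhd ℂ p univ)
    (hXd : Differentiable ℂ X) {z η : V} {w σ : ℂ} (h : w - conj σ = 2 * I * ⟪p η, p z⟫_ℂ) :
    tangencyForm p X η (z, w) = conj (tangencyForm p X z (η, σ)) := by
  have hpd : Differentiable ℂ p := fun z => (hp z trivial).differentiableAt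
  have hpd' : Differentiable ℂ (fderiv ℂ p) := fun z => (hp.fderiv z trivial).differentiableAt
  let G : V × ℂ → V × ℂ → ℂ := fun x y =>
    tangencyForm p X y.1 (x.1, (x.2 + conj y.2) / 2 + I * ⟪p y.1, p x.1⟫_ℂ)
  have hG : IsSesquiholomorphic G := by
    intro x y v s
    have hinner {b : ℂ → E} (hb : Differentiable ℂ b) :
        Differentiable ℂ fun c : ℂ => ⟪p (y.1 + conj c • s.1), b c⟫_ℂ :=
      differentiable_inner_comp_conj (a := fun c => p (y.1 + c • s.1)) (by fun_prop) hb
    have hw : Differentiable ℂ fun c : ℂ => ((x + c • v).1, ((x + c • v).2 +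
        conj (y + conj c • s).2) / 2 + I * ⟪p (y + conj c • s).1, p (x + c • v).1⟫_ℂ) := by
      have := hinner (b := fun c => p (x.1 + c • v.1)) (by fun_prop)
      simp only [Prod.fst_add, Prod.smul_fst, Prod.snd_add, Prod.smul_snd, smul_eq_mul, map_add,
        map_mul, conj_conj]
      fun_prop
    have hXw := hXd.comp hw
    refine hXw.snd.sub (.const_mul (hinner (.clm_apply ?_ hXw.fst)) _)
    exact hpd'.comp (by fun_prop)
  have hreal (x : V × ℂ) : (G x x).im = 0 := by
    simpa [G, inner_self_eq_norm_sq_to_K, add_conj] using hX x.1 x.2.re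
  have hσ : conj w + I * ⟪p z, p η⟫_ℂ + I * ⟪p z, p η⟫_ℂ = σ := by
    have := congrArg conj h
    simp only [map_sub, conj_conj, map_mul, map_ofNat, conj_I, inner_conj_symm] at this
    linear_combination this
  simpa only [G, map_zero, add_zero, zero_add, mul_div_cancel_left₀ _ (two_ne_zero' ℂ),
    sub_add_cancel, map_mul, map_sub, map_ofNat, conj_I, inner_conj_symm, neg_mul, sub_neg_eq_add,
    hσ] using hG.eq_conj_swap hreal (z, 2 * (w - I * ⟪p η, p z⟫_ℂ)) (η, 0)

lemma inner_conj_inv_smul_smul (hom : ∀ (c : ℂ) z, p (c • z) = c ^ d • p z) {t : ℂ} (ht : t ≠ 0)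
    (z η : V) : ⟪p ((conj t)⁻¹ • η), p (t • z)⟫_ℂ = ⟪p η, p z⟫_ℂ := by
  simp only [hom, inner_smul_left, inner_smul_right, map_pow, map_inv₀, conj_conj, inv_pow]
  field_simp

lemma exists_eq_smul (hd : d ≠ 0) (hom : ∀ (c : ℂ) z, p (c • z) = c ^ d • p z) (a : ℂ) (z : V) :
    ∃ η, p η = a • p z := by
  obtain ⟨c, hc⟩ := IsAlgClosed.exists_pow_nat_eq a (Nat.pos_of_ne_zero hd)
  exact ⟨c • z, by rw [hom, hc]⟩

lemma tangencyForm_conj_inv_smul (hom : ∀ (c : ℂ) z, p (c • z) = c ^ d • p z) {t : ℂ} (ht : t ≠ 0)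
    (z η : V) (w : ℂ) : tangencyForm p X ((conj t)⁻¹ • η) (t • z, w) =
      (X (t • z, w)).2 - 2 * I * (t⁻¹ * ⟪p η, fderiv ℂ p z (X (t • z, w)).1⟫_ℂ) := by
  have hD : t • fderiv ℂ p (t • z) = t ^ d • fderiv ℂ p z := by
    rw [← fderiv_comp_smul, funext (hom t)]
    exact congrFun (fderiv_const_smul_field (f := p) (t ^ d)) z
  have hD' : fderiv ℂ p (t • z) = t⁻¹ • t ^ d • fderiv ℂ p z := by
    rw [← hD, inv_smul_smul₀ ht]
  simp only [tangencyForm, hD', hom, smul_apply, inner_smul_left, inner_smul_right, map_pow,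
    map_inv₀, conj_conj, inv_pow]
  field_simp

lemma tendsto_inv_pow_smul_comp_smul {W F : Type*} [NormedAddCommGroup W] [NormedSpace ℂ W]
    [NormedAddCommGroup F] [NormedSpace ℂ F] {N j : ℕ} {G : W → F}
    (hG : G =O[𝓝 0] fun x => ‖x‖ ^ N) (hj : j < N) (x : W) :
    Tendsto (fun s : ℂ => (s⁻¹) ^ j • G (s • x)) (𝓝[≠] 0) (𝓝 0) := by
  have h0 : Tendsto (fun s : ℂ => s • x) (𝓝[≠] 0) (𝓝 0) :=
    ((continuous_id.smul continuous_const).tendsto' 0 0 (zero_smul ℂ x)).mono_left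
      nhdsWithin_le_nhds
  have hO : (fun s : ℂ => G (s • x)) =O[𝓝[≠] 0] fun s => s ^ N := by
    refine (hG.comp_tendsto h0).trans (IsBigO.of_bound (‖x‖ ^ N) (Eventually.of_forall fun s => ?_))
    simp [norm_smul, mul_pow, mul_comm]
  have ho : (fun s : ℂ => s ^ N) =o[𝓝[≠] 0] fun s => s ^ j :=
    (isLittleO_pow_pow hj).mono nhdsWithin_le_nhds
  simpa only [inv_pow] using (hO.trans_isLittleO ho).tendsto_inv_smul_nhds_zero

lemma tendsto_conj_inv_cocompact : Tendsto (fun t : ℂ => (conj t)⁻¹) (cocompact ℂ) (𝓝[≠] 0) := by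
  rw [← Metric.cobounded_eq_cocompact]
  refine tendsto_inv₀_cobounded'.comp ?_
  rw [Metric.cobounded_eq_cocompact]
  exact conjCLE.toHomeomorph.isClosedEmbedding.tendsto_cocompact

/-- The two sides of `tangencyForm_eq_conj` decouple on the locus `σ = 0`: along the scaling
`(z, η) ↦ (t z, t̄⁻¹ η)` the left side is entire in `t`, and the right side tends to `0`. -/
theorem IsInfinitesimalAutomorphism.tangencyForm_eq_zero [CompleteSpace E]
    (hX : IsInfinitesimalAutomorphism p X) (hp : AnalyticOnNhd ℂ p univ)
    (hom : ∀ (c : ℂ) z, p (c • z) = c ^ d • p z) (hXd : Differentiable ℂ X)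
    (hX3 : X =O[𝓝 0] fun x => ‖x‖ ^ 3) {z η : V} {w : ℂ} (hw : w = 2 * I * ⟪p η, p z⟫_ℂ) :
    tangencyForm p X η (z, w) = 0 := by
  let φ : ℂ → ℂ := fun t =>
    t * (X (t • z, w)).2 - 2 * I * ⟪p η, fderiv ℂ p z (X (t • z, w)).1⟫_ℂ
  have hφ : Differentiable ℂ φ := by
    have hXt : Differentiable ℂ fun t : ℂ => X (t • z, w) := hXd.comp (by fun_prop)
    have hin := (innerSL ℂ (p η)).differentiable.comp
      ((fderiv ℂ p z).differentiable.comp hXt.fst)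
    exact (differentiable_id.mul hXt.snd).sub (hin.const_mul (2 * I))
  let L : (V × ℂ) × (V × ℂ) → ℂ := fun v => conj (v.1.2 - 2 * I * ⟪p z, fderiv ℂ p η v.2.1⟫_ℂ)
  let ψ : ℂ → ℂ := fun s => L (s⁻¹ ^ 1 • X (s • (η, 0)), s⁻¹ ^ 2 • X (s • (η, 0)))
  have hφψ : ∀ t : ℂ, t ≠ 0 → φ t = ψ (conj t)⁻¹ := by
    intro t ht
    have hs : (conj t)⁻¹ ≠ 0 := inv_ne_zero ((map_ne_zero conj).2 ht)
    have h := hX.tangencyForm_eq_conj hp hXd (z := t • z) (η := (conj t)⁻¹ • η) (w := w) (σ := 0)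
      (by rw [inner_conj_inv_smul_smul hom ht, map_zero, sub_zero, hw])
    have h' := tangencyForm_conj_inv_smul (X := X) hom hs η z 0
    simp only [map_inv₀, conj_conj, inv_inv] at h'
    rw [tangencyForm_conj_inv_smul hom ht, h'] at h
    simp only [map_sub, map_mul, map_ofNat, conj_I, conj_conj, inner_conj_symm] at h
    simp only [φ, ψ, L, inv_inv, pow_one, Prod.smul_mk, Prod.smul_snd, Prod.smul_fst,
      map_smul, map_pow, inner_smul_left, map_sub, map_mul, map_ofNat, conj_I, conj_conj,
      inner_conj_symm, smul_eq_mul, mul_zero]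
    linear_combination t * h + 2 * I * ⟪p η, fderiv ℂ p z (X (t • z, w)).1⟫_ℂ * mul_inv_cancel₀ ht
  have hψ : Tendsto ψ (𝓝[≠] 0) (𝓝 0) := by
    have hL : Continuous L := by fun_prop
    exact (hL.tendsto' 0 0 (by simp [L])).comp <|
      (tendsto_inv_pow_smul_comp_smul hX3 (by norm_num) (η, 0)).prodMk_nhds
        (tendsto_inv_pow_smul_comp_smul hX3 (by norm_num) (η, 0))
  have h1 := hφ.apply_eq_of_tendsto_cocompact 1 (c := 0) <|
    (hψ.comp tendsto_conj_inv_cocompact).congr' <| by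
      filter_upwards [isCompact_singleton.compl_mem_cocompact] with t ht using (hφψ t ht).symm
  simpa [φ, tangencyForm] using h1

lemma dense_setOf_ne_zero (hp : AnalyticOnNhd ℂ p univ) (hne : p ≠ 0) : Dense {z | p z ≠ 0} := by
  intro z
  by_contra hz
  rw [mem_closure_iff_frequently, not_frequently] at hz
  refine hne (funext fun y => hp.eqOn_zero_of_preconnected_of_eventuallyEq_zero
    isPreconnected_univ (mem_univ z) ?_ (mem_univ y))
  filter_upwards [hz] with y hy using not_not.1 hy

variable [CompleteSpace E] (hd : d ≠ 0) (hp : AnalyticOnNhd ℂ p univ)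
  (hom : ∀ (c : ℂ) z, p (c • z) = c ^ d • p z) (hX : IsInfinitesimalAutomorphism p X)
  (hXd : Differentiable ℂ X) (hX3 : X =O[𝓝 0] fun x => ‖x‖ ^ 3)

include hd hp hom hX hXd hX3

theorem IsInfinitesimalAutomorphism.snd_mul_inner_eq {z η : V} (hS : ⟪p η, p z⟫_ℂ ≠ 0) (w : ℂ) :
    (X (z, w)).2 * ⟪p η, p z⟫_ℂ = w * ⟪p η, fderiv ℂ p z (X (z, w)).1⟫_ℂ := by
  obtain ⟨η', hη'⟩ := exists_eq_smul hd hom (conj (w / (2 * I * ⟪p η, p z⟫_ℂ))) η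
  have h := hX.tangencyForm_eq_zero hp hom hXd hX3 (z := z) (η := η') (w := w) <| by
    rw [hη', inner_smul_left, conj_conj]
    field_simp
  rw [tangencyForm, hη', inner_smul_left, conj_conj, sub_eq_zero] at h
  rw [h]
  field_simp

theorem IsInfinitesimalAutomorphism.snd_mul_sq_eq {z η : V} {w τ : ℂ} (hwτ : w ≠ τ)
    (h : w - τ = 2 * I * ⟪p η, p z⟫_ℂ) :
    (X (z, w)).2 * τ ^ 2 = conj (X (η, conj τ)).2 * w ^ 2 := by
  have hS : ⟪p η, p z⟫_ℂ ≠ 0 := fun h0 => hwτ (sub_eq_zero.1 (by rw [h, h0, mul_zero]))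
  have hS' : ⟪p z, p η⟫_ℂ ≠ 0 := by rwa [← inner_conj_symm, ne_eq, map_eq_zero]
  have hpol := hX.tangencyForm_eq_conj hp hXd (z := z) (η := η) (w := w) (σ := conj τ)
    (by rw [conj_conj, h])
  have hz := hX.snd_mul_inner_eq hd hp hom hXd hX3 hS w
  have hη := congrArg conj (hX.snd_mul_inner_eq hd hp hom hXd hX3 hS' (conj τ))
  simp only [tangencyForm, map_sub, map_mul, map_ofNat, conj_I, inner_conj_symm, conj_conj]
    at hpol hη
  have key : ((X (z, w)).2 - conj (X (η, conj τ)).2) * (w * τ) =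
      (w - τ) * ((X (z, w)).2 * τ + conj (X (η, conj τ)).2 * w) := by
    rw [h]
    linear_combination w * τ * hpol - 2 * I * τ * hz - 2 * I * w * hη
  linear_combination key

/-- Replacing `(z, η)` by `(t z, t̄⁻¹ η)` in `snd_mul_sq_eq` and letting `t → ∞` removes the
dependence on `η`, by the theorem of Liouville. -/
theorem IsInfinitesimalAutomorphism.snd_mul_sq_eq_conj_zero {z : V} {w τ : ℂ} (hz : p z ≠ 0)
    (hwτ : w ≠ τ) :
    (X (z, w)).2 * τ ^ 2 = conj (X (0, conj τ)).2 * w ^ 2 := by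
  obtain ⟨η, hη⟩ := exists_eq_smul hd hom (conj ((w - τ) / (2 * I * ⟪p z, p z⟫_ℂ))) z
  have hη : w - τ = 2 * I * ⟪p η, p z⟫_ℂ := by
    have : ⟪p z, p z⟫_ℂ ≠ 0 := inner_self_ne_zero.2 hz
    rw [hη, inner_smul_left, conj_conj]
    field_simp
  have hentire : Differentiable ℂ fun t : ℂ => (X (t • z, w)).2 * τ ^ 2 :=
    (hXd.comp (by fun_prop : Differentiable ℂ fun t : ℂ => (t • z, w))).snd.mul_const _
  have hlim : Tendsto (fun s : ℂ => conj (X (s • η, conj τ)).2 * w ^ 2) (𝓝[≠] 0)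
      (𝓝 (conj (X (0, conj τ)).2 * w ^ 2)) := by
    have hc : Continuous fun s : ℂ => conj (X (s • η, conj τ)).2 * w ^ 2 := by
      have := hXd.continuous
      fun_prop
    exact (hc.tendsto' 0 _ (by rw [zero_smul])).mono_left nhdsWithin_le_nhds
  simpa using hentire.apply_eq_of_tendsto_cocompact 1 <|
    (hlim.comp tendsto_conj_inv_cocompact).congr' <| by
      filter_upwards [isCompact_singleton.compl_mem_cocompact] with t ht
      exact (hX.snd_mul_sq_eq hd hp hom hXd hX3 hwτ
        (by rw [inner_conj_inv_smul_smul hom ht, hη])).symm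

theorem IsInfinitesimalAutomorphism.snd_eq_zero {z : V} {w : ℂ} (hz : p z ≠ 0) (hw : w ≠ 0) :
    (X (z, w)).2 = 0 := by
  have hlim : Tendsto (fun s : ℂ => conj (s⁻¹ ^ 2 • X (s • (0, 1))).2 * w ^ 2) (𝓝[≠] 0) (𝓝 0) := by
    have hc : Continuous fun x : V × ℂ => conj x.2 * w ^ 2 := by fun_prop
    exact (hc.tendsto' 0 0 (by simp)).comp
      (tendsto_inv_pow_smul_comp_smul hX3 (by norm_num) (0, 1))
  have hconst : (fun s : ℂ => conj (s⁻¹ ^ 2 • X (s • (0, 1))).2 * w ^ 2) =ᶠ[𝓝[≠] 0]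
      fun _ => (X (z, w)).2 := by
    have hne : ∀ᶠ s : ℂ in 𝓝[≠] 0, s ≠ conj w :=
      (eventually_ne_nhds ((map_ne_zero conj).2 hw).symm).filter_mono nhdsWithin_le_nhds
    filter_upwards [hne, self_mem_nhdsWithin] with s hsw (hs : s ≠ 0)
    have hs' : conj s ≠ 0 := (map_ne_zero conj).2 hs
    have := hX.snd_mul_sq_eq_conj_zero hd hp hom hXd hX3 hz (w := w) (τ := conj s)
      (fun h => hsw (by rw [h, conj_conj]))
    simp only [conj_conj] at this
    simp only [Prod.smul_mk, smul_zero, smul_eq_mul, mul_one, Prod.smul_snd, map_mul, map_pow,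
      map_inv₀]
    field_simp
    rw [← this, mul_comm]
  exact tendsto_nhds_unique (tendsto_const_nhds.congr' hconst.symm) hlim

theorem IsInfinitesimalAutomorphism.fderiv_fst_eq_zero {z : V} {w : ℂ} (hz : p z ≠ 0) (hw : w ≠ 0) :
    fderiv ℂ p z (X (z, w)).1 = 0 := by
  have hpd : Differentiable ℂ p := fun z => (hp z trivial).differentiableAt
  set ξ := (X (z, w)).1
  set v := fderiv ℂ p z ξ
  have hzero : (fun s : ℂ => ⟪v, p (z + s • ξ)⟫_ℂ) =ᶠ[𝓝 0] fun _ => 0 := by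
    have hc : Continuous fun s : ℂ => ⟪p (z + s • ξ), p z⟫_ℂ := by
      have := hpd.continuous
      fun_prop
    filter_upwards [hc.continuousAt.eventually_ne
      (by simpa [zero_smul, add_zero] using hz : ⟪p (z + (0 : ℂ) • ξ), p z⟫_ℂ ≠ 0)] with s hs
    have := hX.snd_mul_inner_eq hd hp hom hXd hX3 hs w
    rw [hX.snd_eq_zero hd hp hom hXd hX3 hz hw, zero_mul] at this
    rw [← inner_conj_symm, (mul_eq_zero.1 this.symm).resolve_left hw, map_zero]
  have hderiv : HasDerivAt (fun s : ℂ => ⟪v, p (z + s • ξ)⟫_ℂ) ⟪v, v⟫_ℂ 0 :=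
    (innerSL ℂ v).hasFDerivAt.comp_hasDerivAt 0 ((hpd z).hasFDerivAt.hasLineDerivAt ξ)
  exact inner_self_eq_zero.1 (hderiv.unique ((hasDerivAt_const 0 0).congr_of_eventuallyEq hzero))

theorem IsInfinitesimalAutomorphism.annihilates (hne : p ≠ 0) (x : V × ℂ) :
    (X x).2 = 0 ∧ fderiv ℂ p x.1 (X x).1 = 0 := by
  have hdense : Dense ({z | p z ≠ 0} ×ˢ {(0 : ℂ)}ᶜ) :=
    (dense_setOf_ne_zero hp hne).prod (dense_compl_singleton 0)
  have hXc := hXd.continuous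
  have hDp : Continuous (fderiv ℂ p) :=
    continuous_iff_continuousAt.2 fun z => (hp.fderiv z trivial).continuousAt
  constructor
  · refine congrFun (Continuous.ext_on hdense (f := fun x => (X x).2) (by fun_prop)
      continuous_const fun y hy => ?_) x
    exact hX.snd_eq_zero hd hp hom hXd hX3 hy.1 hy.2
  · refine congrFun (Continuous.ext_on hdense (f := fun x => fderiv ℂ p x.1 (X x).1) (by fun_prop)
      continuous_const fun y hy => ?_) x
    exact hX.fderiv_fst_eq_zero hd hp hom hXd hX3 hy.1 hy.2

end Rigidity

section MeanValue

universe u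

variable {𝕜 : Type*} [RCLike 𝕜] {E E' F : Type*} [NormedAddCommGroup E] [NormedSpace 𝕜 E]
  [NormedAddCommGroup E'] [NormedSpace 𝕜 E'] [NormedAddCommGroup F] [NormedSpace 𝕜 F]

lemma isBigO_pow_succ_of_fderiv [NormedSpace ℝ E] {r : E → F} {k : ℕ}
    (hr : ∀ᶠ x in 𝓝 0, DifferentiableAt 𝕜 r x) (hr0 : r 0 = 0)
    (h : fderiv 𝕜 r =O[𝓝 0] fun x => ‖x‖ ^ k) : r =O[𝓝 0] fun x => ‖x‖ ^ (k + 1) := by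
  obtain ⟨C, hC0, hC⟩ := h.exists_pos
  obtain ⟨ε, hε, hball⟩ := Metric.eventually_nhds_iff_ball.1 (hC.bound.and hr)
  refine .of_bound C ?_
  filter_upwards [Metric.ball_mem_nhds (0 : E) hε] with x hx
  have hsub {y : E} (hy : y ∈ Metric.closedBall 0 ‖x‖) : y ∈ Metric.ball 0 ε := by
    rw [mem_closedBall_zero_iff] at hy
    exact mem_ball_zero_iff.2 (hy.trans_lt (mem_ball_zero_iff.1 hx))
  have hD : ∀ y ∈ Metric.closedBall (0 : E) ‖x‖, ‖fderiv 𝕜 r y‖ ≤ C * ‖x‖ ^ k := fun y hy => by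
    refine (hball y (hsub hy)).1.trans ?_
    rw [norm_pow, norm_norm]
    gcongr
    exact mem_closedBall_zero_iff.1 hy
  have := (convex_closedBall (0 : E) ‖x‖).norm_image_sub_le_of_norm_fderiv_le
    (fun y hy => (hball y (hsub hy)).2) hD (x := 0) (y := x) (by simp) (by simp)
  simpa [hr0, pow_succ, mul_assoc] using this

theorem isBigO_pow_of_iteratedFDeriv_eq_zero {E F : Type u} [NormedAddCommGroup E]
    [NormedSpace 𝕜 E] [NormedSpace ℝ E] [NormedAddCommGroup F] [NormedSpace 𝕜 F] {k : ℕ} {r : E → F}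
    (hr : ContDiffAt 𝕜 k r 0) (h : ∀ i < k, iteratedFDeriv 𝕜 i r 0 = 0) :
    r =O[𝓝 0] fun x => ‖x‖ ^ k := by
  induction k generalizing F with
  | zero => simpa using hr.continuousAt.isBigO_one ℝ
  | succ k ih =>
    refine isBigO_pow_succ_of_fderiv (𝕜 := 𝕜) ?_ ?_ (ih (hr.fderiv_right le_rfl) fun i hi => ?_)
    · filter_upwards [hr.eventually (by simp)] with x hx using hx.differentiableAt (by simp)
    · rw [← norm_eq_zero, ← norm_iteratedFDeriv_zero (𝕜 := 𝕜), h 0 (by omega), norm_zero]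
    · rw [← norm_eq_zero, norm_iteratedFDeriv_fderiv, h (i + 1) (by omega), norm_zero]

lemma norm_image_sub_le_of_norm_partial_fderiv_le [NormedSpace ℝ E] [NormedSpace ℝ E']
    {r : E × E' → F} {s : Set E} {t : Set E'} (hs : Convex ℝ s) (ht : Convex ℝ t) {A B : ℝ}
    (hr : ∀ x ∈ s ×ˢ t, DifferentiableAt 𝕜 r x)
    (hA : ∀ x ∈ s ×ˢ t, ‖(fderiv 𝕜 r x).comp (.inl 𝕜 E E')‖ ≤ A)
    (hB : ∀ x ∈ s ×ˢ t, ‖(fderiv 𝕜 r x).comp (.inr 𝕜 E E')‖ ≤ B)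
    {x y : E × E'} (hx : x ∈ s ×ˢ t) (hy : y ∈ s ×ˢ t) :
    ‖r x - r y‖ ≤ A * ‖x.1 - y.1‖ + B * ‖x.2 - y.2‖ := by
  have h1 : ‖r (x.1, x.2) - r (y.1, x.2)‖ ≤ A * ‖x.1 - y.1‖ :=
    hs.norm_image_sub_le_of_norm_hasFDerivWithin_le (𝕜 := 𝕜) (f := fun z => r (z, x.2))
      (fun z hz => ((hr (z, x.2) ⟨hz, hx.2⟩).hasFDerivAt.comp z
        (hasFDerivAt_prodMk_left z x.2)).hasFDerivWithinAt)
      (fun z hz => hA (z, x.2) ⟨hz, hx.2⟩) hy.1 hx.1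
  have h2 : ‖r (y.1, x.2) - r (y.1, y.2)‖ ≤ B * ‖x.2 - y.2‖ :=
    ht.norm_image_sub_le_of_norm_hasFDerivWithin_le (𝕜 := 𝕜) (f := fun u => r (y.1, u))
      (fun u hu => ((hr (y.1, u) ⟨hy.1, hu⟩).hasFDerivAt.comp u
        (hasFDerivAt_prodMk_right y.1 u)).hasFDerivWithinAt)
      (fun u hu => hB (y.1, u) ⟨hy.1, hu⟩) hy.2 hx.2
  exact (norm_sub_le_norm_sub_add_norm_sub _ _ _).trans (add_le_add h1 h2)

lemma partial_inl_isBigO {r : E × E' → F} {m : ℕ} (hr : ∀ᶠ x in 𝓝 0, DifferentiableAt 𝕜 r x)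
    (hD : ContDiffAt 𝕜 1 (fderiv 𝕜 r) 0)
    (hflat : fderiv 𝕜 (fun z => r (z, 0)) =O[𝓝 0] fun z => ‖z‖ ^ m) :
    (fun x => (fderiv 𝕜 r x).comp (.inl 𝕜 E E')) =O[𝓝 0] fun x => ‖x.1‖ ^ m + ‖x.2‖ := by
  have hproj : Tendsto (fun x : E × E' => (x.1, (0 : E'))) (𝓝 0) (𝓝 0) :=
    (by fun_prop : Continuous fun x : E × E' => (x.1, (0 : E'))).tendsto' _ _ rfl
  have hlip : (fun x : E × E' => fderiv 𝕜 r x - fderiv 𝕜 r (x.1, 0)) =O[𝓝 0] fun x => ‖x.2‖ :=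
    ((hD.hasStrictFDerivAt (by simp)).isBigO_sub.comp_tendsto
      (tendsto_id.prodMk_nhds hproj)).trans <| .of_bound 1 <| .of_forall fun x => by
        simp [Prod.norm_def]
  have hz : (fun x : E × E' => (fderiv 𝕜 r (x.1, 0)).comp (.inl 𝕜 E E')) =O[𝓝 0]
      fun x => ‖x.1‖ ^ m := by
    refine (hflat.comp_tendsto (continuous_fst.tendsto (0 : E × E'))).congr' ?_ .rfl
    filter_upwards [hproj.eventually hr] with x hx
    exact (hx.hasFDerivAt.comp x.1 (hasFDerivAt_prodMk_left x.1 (0 : E'))).fderiv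
  have hsub : (fun x : E × E' => (fderiv 𝕜 r x - fderiv 𝕜 r (x.1, 0)).comp (.inl 𝕜 E E')) =O[𝓝 0]
      fun x => ‖x.2‖ := by
    refine IsBigO.trans (.of_bound 1 <| .of_forall fun x => ?_) hlip
    rw [one_mul]
    exact (ContinuousLinearMap.opNorm_comp_le _ _).trans
      (mul_le_of_le_one_right (norm_nonneg _) (ContinuousLinearMap.norm_inl_le_one 𝕜 E E'))
  refine ((hz.trans (.of_bound 1 <| .of_forall fun x => ?_)).add
    (hsub.trans (.of_bound 1 <| .of_forall fun x => ?_))).congr_left fun x => ?_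
  · simpa only [one_mul, norm_pow, norm_norm] using
      (le_add_of_nonneg_right (norm_nonneg x.2)).trans (Real.le_norm_self _)
  · simpa only [one_mul, norm_norm] using
      (le_add_of_nonneg_left (by positivity : 0 ≤ ‖x.1‖ ^ m)).trans (Real.le_norm_self _)
  · rw [ContinuousLinearMap.sub_comp, add_sub_cancel]

lemma partial_inr_isBigO {r : E × E' → F} (hD : ContDiffAt 𝕜 1 (fderiv 𝕜 r) 0)
    (hinr : (fderiv 𝕜 r 0).comp (.inr 𝕜 E E') = 0) :
    (fun x => (fderiv 𝕜 r x).comp (.inr 𝕜 E E')) =O[𝓝 0] fun x => ‖x‖ := by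
  have := ((hD.differentiableAt (by simp)).clm_comp (differentiableAt_const
    (ContinuousLinearMap.inr 𝕜 E E'))).isBigO_sub
  simpa [hinr] using this.norm_right

/-- The modulus of continuity on `E × E'` of a smooth function of weighted order greater than one,
where `E` has weight `1 / m` and `E'` has weight `1`. -/
def weightedModulus (m : ℕ) (q : (E × E') × (E × E')) : ℝ :=
  ((‖q.1.1‖ + ‖q.2.1‖) ^ m + (‖q.1.2‖ + ‖q.2.2‖)) * ‖q.1.1 - q.2.1‖ +
    (‖q.1‖ + ‖q.2‖) * ‖q.1.2 - q.2.2‖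

theorem sub_isBigO_weightedModulus [NormedSpace ℝ E] [NormedSpace ℝ E'] {r : E × E' → F} {m : ℕ}
    (hr : ContDiffAt 𝕜 2 r 0) (hflat : fderiv 𝕜 (fun z => r (z, 0)) =O[𝓝 0] fun z => ‖z‖ ^ m)
    (hinr : (fderiv 𝕜 r 0).comp (.inr 𝕜 E E') = 0) :
    (fun q : (E × E') × (E × E') => r q.1 - r q.2) =O[𝓝 0] weightedModulus m := by
  have hdiff : ∀ᶠ x in 𝓝 (0 : E × E'), DifferentiableAt 𝕜 r x := by
    filter_upwards [hr.eventually (by simp)] with x hx using hx.differentiableAt (by simp)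
  have hD : ContDiffAt 𝕜 1 (fderiv 𝕜 r) 0 := hr.fderiv_right (by norm_num)
  obtain ⟨A, hA0, hA⟩ := (partial_inl_isBigO hdiff hD hflat).exists_pos
  obtain ⟨B, hB0, hB⟩ := (partial_inr_isBigO hD hinr).exists_pos
  obtain ⟨ε, hε, hball⟩ :=
    Metric.eventually_nhds_iff_ball.1 (hdiff.and (hA.bound.and hB.bound))
  refine .of_bound (A + B) ?_
  filter_upwards [Metric.ball_mem_nhds 0 (half_pos hε)] with q hq
  rw [mem_ball_zero_iff] at hq
  have hsum : ‖q.1‖ + ‖q.2‖ < ε := by linarith [norm_fst_le q, norm_snd_le q]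
  set a : ℝ := ‖q.1.1‖ + ‖q.2.1‖
  set b : ℝ := ‖q.1.2‖ + ‖q.2.2‖
  have ha : a ≤ ‖q.1‖ + ‖q.2‖ := add_le_add (norm_fst_le _) (norm_fst_le _)
  have hb : b ≤ ‖q.1‖ + ‖q.2‖ := add_le_add (norm_snd_le _) (norm_snd_le _)
  have hbox {x : E × E'} (hx : x ∈ Metric.closedBall 0 a ×ˢ Metric.closedBall 0 b) :
      ‖x.1‖ ≤ a ∧ ‖x.2‖ ≤ b ∧ ‖x‖ ≤ ‖q.1‖ + ‖q.2‖ ∧ x ∈ Metric.ball 0 ε := by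
    simp only [mem_prod, mem_closedBall_zero_iff] at hx
    have hx' : ‖x‖ ≤ ‖q.1‖ + ‖q.2‖ := max_le (hx.1.trans ha) (hx.2.trans hb)
    exact ⟨hx.1, hx.2, hx', mem_ball_zero_iff.2 (hx'.trans_lt hsum)⟩
  have key := norm_image_sub_le_of_norm_partial_fderiv_le (𝕜 := 𝕜) (r := r) (x := q.1) (y := q.2)
    (A := A * (a ^ m + b)) (B := B * (‖q.1‖ + ‖q.2‖)) (convex_closedBall (0 : E) a)
    (convex_closedBall (0 : E') b) (fun x hx => (hball x (hbox hx).2.2.2).1) (fun x hx => ?_)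
    (fun x hx => ?_) (by simp [a, b]) (by simp [a, b])
  · refine key.trans ?_
    rw [weightedModulus, Real.norm_of_nonneg (by positivity), mul_assoc, mul_assoc,
      add_mul A B]
    refine add_le_add (mul_le_mul_of_nonneg_left ?_ hA0.le) (mul_le_mul_of_nonneg_left ?_ hB0.le)
    exacts [le_add_of_nonneg_right (by positivity), le_add_of_nonneg_left (by positivity)]
  · obtain ⟨hx1, hx2, -, hx⟩ := hbox hx
    refine (hball x hx).2.1.trans ?_
    rw [Real.norm_of_nonneg (by positivity)]
    gcongr
  · obtain ⟨-, -, hx', hx⟩ := hbox hx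
    refine (hball x hx).2.2.trans ?_
    rw [norm_norm]
    gcongr

theorem isLittleO_of_isBigO_weightedModulus [NormedSpace ℝ E] {r : E × E' → F} {m : ℕ}
    (hr : (fun q : (E × E') × (E × E') => r q.1 - r q.2) =O[𝓝 0] weightedModulus m)
    (hr0 : r 0 = 0) :
    r =o[𝓝 0] fun x => ‖x.1‖ ^ m + ‖x.2‖ := by
  have h0 : Tendsto (fun x : E × E' => (x, (0 : E × E'))) (𝓝 0) (𝓝 0) :=
    (by fun_prop : Continuous fun x : E × E' => (x, (0 : E × E'))).tendsto' _ _ rfl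
  have hO : r =O[𝓝 0] fun x => ‖x‖ * (‖x.1‖ ^ m + ‖x.2‖) := by
    refine ((hr.comp_tendsto h0).congr_left fun x => by simp [hr0]).trans <| .of_bound 2 <|
      .of_forall fun x => ?_
    have h1 := mul_le_mul_of_nonneg_left (norm_fst_le x) (by positivity : 0 ≤ ‖x.1‖ ^ m + ‖x.2‖)
    have h2 : 0 ≤ ‖x‖ * ‖x.1‖ ^ m := by positivity
    simp only [Function.comp_apply, weightedModulus, Prod.fst_zero, Prod.snd_zero, norm_zero,
      add_zero, sub_zero]
    rw [Real.norm_of_nonneg (by positivity), Real.norm_of_nonneg (by positivity)]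
    linarith
  refine hO.trans_isLittleO ?_
  simpa using ((isLittleO_one_iff ℝ).2 (tendsto_norm_zero (E := E × E'))).mul_isBigO
    (isBigO_refl (fun x : E × E' => ‖x.1‖ ^ m + ‖x.2‖) (𝓝 0))

theorem weightedModulus_add_isLittleO {α : Type*} {l : Filter α} {τ : α → ℝ} {x h : α → E × E'}
    {m N : ℕ} (hm : m ≠ 0) (hτ : Tendsto τ l (𝓝 0)) (hx : Tendsto x l (𝓝 0))
    (hh : Tendsto h l (𝓝 0)) (hx1 : (fun a => (x a).1) =O[l] τ)
    (hx2 : (fun a => (x a).2) =O[l] fun a => τ a ^ m) (hh1 : (fun a => (h a).1) =O[l] τ)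
    (hN1 : (fun a => τ a ^ (m - 1) * ‖(h a).1‖) =O[l] fun a => τ a ^ N)
    (hN2 : (fun a => (h a).2) =O[l] fun a => τ a ^ N) :
    (fun a => weightedModulus m (x a + h a, x a)) =o[l] fun a => τ a ^ N := by
  have hτN : (fun a => τ a ^ m * ‖(h a).1‖) =o[l] fun a => τ a ^ N := by
    refine (((isLittleO_one_iff ℝ).2 hτ).mul_isBigO hN1).congr (fun a => ?_) fun a => one_mul _
    rw [← mul_assoc, mul_pow_sub_one hm]
  have hpow : (fun a => (‖(x a).1 + (h a).1‖ + ‖(x a).1‖) ^ m * ‖(h a).1‖) =o[l]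
      fun a => τ a ^ N :=
    ((((hx1.add hh1).norm_left.add hx1.norm_left).pow m).mul (isBigO_refl _ l)).trans_isLittleO hτN
  have hx2h1 : (fun a => ‖(x a).2‖ * ‖(h a).1‖) =o[l] fun a => τ a ^ N :=
    (hx2.norm_left.mul (isBigO_refl _ l)).trans_isLittleO hτN
  have hh2h1 : (fun a => ‖(h a).2‖ * ‖(h a).1‖) =o[l] fun a => τ a ^ N := by
    have : Tendsto (fun a => ‖(h a).1‖) l (𝓝 0) := by
      simpa using (continuous_fst.tendsto _).comp hh |>.norm
    simpa using hN2.norm_left.mul_isLittleO ((isLittleO_one_iff ℝ).2 this)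
  have hsum : (fun a => ‖(x a).2 + (h a).2‖ * ‖(h a).1‖) =o[l] fun a => τ a ^ N := by
    refine IsBigO.trans_isLittleO (.of_norm_le fun a => ?_) (hx2h1.add hh2h1)
    rw [← add_mul, norm_mul, norm_norm, norm_norm]
    gcongr
    exact norm_add_le _ _
  have hlast : (fun a => (‖x a + h a‖ + ‖x a‖) * ‖(h a).2‖) =o[l] fun a => τ a ^ N := by
    have : Tendsto (fun a => ‖x a + h a‖ + ‖x a‖) l (𝓝 0) := by
      simpa using (hx.add hh).norm.add hx.norm
    simpa using ((isLittleO_one_iff ℝ).2 this).mul_isBigO hN2.norm_left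
  refine ((hpow.add (hsum.add hx2h1)).add hlast).congr_left fun a => ?_
  simp only [weightedModulus, Prod.fst_add, Prod.snd_add, add_sub_cancel_left]
  ring

end MeanValue

section WeightedDerivatives

lemma iteratedFDeriv_comp_right_of_contDiffAt {𝕜 E E' F : Type*} [NontriviallyNormedField 𝕜]
    [NormedAddCommGroup E] [NormedSpace 𝕜 E] [NormedAddCommGroup E'] [NormedSpace 𝕜 E']
    [NormedAddCommGroup F] [NormedSpace 𝕜 F] {f : E → F} (g : E' →L[𝕜] E) {x : E'} {i : ℕ}
    (hf : ContDiffAt 𝕜 i f (g x)) : iteratedFDeriv 𝕜 i (f ∘ g) x =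
      (iteratedFDeriv 𝕜 i f (g x)).compContinuousLinearMap fun _ => g := by
  obtain ⟨u, hu, hxu, hfu⟩ := hf.contDiffWithinAt.contDiffOn' (s := univ) le_rfl (by simp)
  rw [insert_eq_of_mem (mem_univ _), univ_inter] at hfu
  have hpre : IsOpen (g ⁻¹' u) := hu.preimage g.continuous
  rw [← iteratedFDerivWithin_of_isOpen i hpre hxu, ← iteratedFDerivWithin_of_isOpen i hu hxu]
  exact g.iteratedFDerivWithin_comp_right hfu hu.uniqueDiffOn hpre.uniqueDiffOn hxu le_rfl

variable {n m : ℕ} {r : (Fin n → ℂ) × ℝ → ℝ}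

namespace WeightedDerivativesVanish

lemma apply_zero (hW : WeightedDerivativesVanish m r) : r 0 = 0 := by
  simpa using hW 0 0 (by simp) Fin.elim0

lemma fderiv_comp_inr (hW : WeightedDerivativesVanish m r) :
    (fderiv ℝ r 0).comp (.inr ℝ (Fin n → ℂ) ℝ) = 0 := by
  ext
  exact (iteratedFDeriv_one_apply _).symm.trans (hW 0 1 (by simp) Fin.elim0)

lemma iteratedFDeriv_left_eq_zero (hW : WeightedDerivativesVanish m r)
    (hr : ContDiffAt ℝ m r 0) {j : ℕ} (hj : j ≤ m) :
    iteratedFDeriv ℝ j (fun z => r (z, 0)) 0 = 0 := by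
  ext v
  have hweight : ((0 : ℕ) : ℚ) + (j : ℚ) / (m : ℚ) ≤ 1 := by
    rw [Nat.cast_zero, zero_add]
    exact div_le_one_of_le₀ (by exact_mod_cast hj) m.cast_nonneg
  have happend :
      Fin.append (fun i => (v i, (0 : ℝ))) (fun _ : Fin 0 => ((0 : Fin n → ℂ), (1 : ℝ))) =
        fun i => (v i, 0) := funext fun i => Fin.append_left _ _ i
  have hcomp := iteratedFDeriv_comp_right_of_contDiffAt (.inl ℝ (Fin n → ℂ) ℝ) (x := 0)
    (hr.of_le (by exact_mod_cast hj) : ContDiffAt ℝ j r 0)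
  have hvanish := hW j 0 hweight v
  rw [happend] at hvanish
  exact (DFunLike.congr_fun hcomp v).trans hvanish

theorem fderiv_left_isBigO (hW : WeightedDerivativesVanish m r) (hr : ContDiffAt ℝ ∞ r 0) :
    fderiv ℝ (fun z => r (z, 0)) =O[𝓝 0] fun z => ‖z‖ ^ m := by
  have hrz : ContDiffAt ℝ ∞ (fun z => r (z, 0)) 0 :=
    hr.comp (0 : Fin n → ℂ) (contDiffAt_id.prodMk contDiffAt_const)
  refine isBigO_pow_of_iteratedFDeriv_eq_zero (hrz.fderiv_right (mod_cast le_top)) fun i hi => ?_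
  rw [← norm_eq_zero, norm_iteratedFDeriv_fderiv,
    hW.iteratedFDeriv_left_eq_zero (hr.of_le (mod_cast le_top)) hi, norm_zero]

theorem sub_isBigO (hW : WeightedDerivativesVanish m r) (hr : ContDiffAt ℝ ∞ r 0) :
    (fun q : ((Fin n → ℂ) × ℝ) × ((Fin n → ℂ) × ℝ) => r q.1 - r q.2) =O[𝓝 0] weightedModulus m :=
  sub_isBigO_weightedModulus (𝕜 := ℝ) (mod_cast contDiffAt_infty.1 hr 2)
    (hW.fderiv_left_isBigO hr) hW.fderiv_comp_inr

end WeightedDerivativesVanish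

end WeightedDerivatives

section Expansion

variable {E F : Type*} [NormedAddCommGroup E] [NormedAddCommGroup F] [NormedSpace ℂ F]
  {Φ Φ' : ℂ × E → F} {x : ℂ × E} {y₀ : E} {N : ℕ}

lemma isLittleO_pow_succ_of_hasDerivAt_left
    (hder : ∀ᶠ x in 𝓝 (0, y₀), HasDerivAt (fun s => Φ (s, x.2)) (Φ' x) x.1)
    (h0 : ∀ y, Φ (0, y) = 0) (h : Φ' =o[𝓝 (0, y₀)] fun x => x.1 ^ N) :
    Φ =o[𝓝 (0, y₀)] fun x => x.1 ^ (N + 1) := by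
  refine isLittleO_iff.2 fun c hc => ?_
  have hev := (isLittleO_iff.1 h hc).and hder
  rw [nhds_prod_eq] at hev ⊢
  obtain ⟨pa, hpa, pb, hpb, hab⟩ := eventually_prod_iff.1 hev
  obtain ⟨ε, hε, hball⟩ := Metric.eventually_nhds_iff_ball.1 hpa
  filter_upwards [prod_mem_prod (Metric.ball_mem_nhds 0 hε) hpb] with ⟨t, y⟩ ⟨ht, hy⟩
  have hs {s : ℂ} (hs : s ∈ Metric.closedBall 0 ‖t‖) :=
    hab (hball s (Metric.closedBall_subset_ball (mem_ball_zero_iff.1 ht) hs)) hy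
  have := (convex_closedBall (0 : ℂ) ‖t‖).norm_image_sub_le_of_norm_hasDerivWithin_le
    (f := fun s => Φ (s, y)) (C := c * ‖t‖ ^ N) (fun s h => (hs h).2.hasDerivWithinAt)
    (fun s h => (hs h).1.trans ?_) (x := 0) (y := t) (by simp) (by simp)
  · simpa [h0, pow_succ, mul_assoc] using this
  · rw [norm_pow]
    gcongr
    exact mem_closedBall_zero_iff.1 h

variable [NormedSpace ℂ E]

lemma hasDerivAt_left_of_analyticAt (h : AnalyticAt ℂ Φ x) :
    HasDerivAt (fun s => Φ (s, x.2)) (fderiv ℂ Φ x (1, 0)) x.1 :=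
  HasFDerivAt.comp_hasDerivAt x.1 h.differentiableAt.hasFDerivAt
    ((hasDerivAt_id x.1).prodMk (hasDerivAt_const x.1 x.2))

lemma analyticAt_iteratedDeriv_left [CompleteSpace F] (h : AnalyticAt ℂ Φ x) (j : ℕ) :
    AnalyticAt ℂ (fun x => iteratedDeriv j (fun s => Φ (s, x.2)) x.1) x := by
  induction j with
  | zero => simpa using h
  | succ j ih =>
    have hd := ((ContinuousLinearMap.apply ℂ F ((1, 0) : ℂ × E)).analyticAt _).comp ih.fderiv
    refine hd.congr ?_
    filter_upwards [ih.eventually_analyticAt] with x hx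
    rw [iteratedDeriv_succ]
    exact (hasDerivAt_left_of_analyticAt hx).deriv.symm

theorem sub_pow_smul_iteratedDeriv_isLittleO [CompleteSpace F] (hΦ : AnalyticAt ℂ Φ (0, y₀))
    (h : ∀ j < N, ∀ y, iteratedDeriv j (fun s => Φ (s, y)) 0 = 0) :
    (fun x => Φ x - x.1 ^ N • (N.factorial : ℂ)⁻¹ • iteratedDeriv N (fun s => Φ (s, x.2)) 0)
      =o[𝓝 (0, y₀)] fun x => x.1 ^ N := by
  induction N generalizing Φ with
  | zero =>
    have hc : ContinuousAt (fun x : ℂ × E => Φ x - Φ (0, x.2)) (0, y₀) :=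
      hΦ.continuousAt.sub (ContinuousAt.comp (g := Φ) hΦ.continuousAt (by fun_prop))
    simpa [isLittleO_one_iff] using hc.tendsto
  | succ N ih =>
    let Φ' : ℂ × E → F := fun x => deriv (fun s => Φ (s, x.2)) x.1
    have hΦ' : AnalyticAt ℂ Φ' (0, y₀) := by
      simpa only [iteratedDeriv_one] using analyticAt_iteratedDeriv_left hΦ 1
    have hiter (j : ℕ) (y : E) : iteratedDeriv j (fun s => Φ' (s, y)) =
        iteratedDeriv (j + 1) fun s => Φ (s, y) :=
      (iteratedDeriv_succ' (f := fun s => Φ (s, y))).symm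
    refine isLittleO_pow_succ_of_hasDerivAt_left ?_ (fun y => by simpa using h 0 N.succ_pos y)
      (ih hΦ' fun j hj y => by rw [hiter, h (j + 1) (by omega)])
    filter_upwards [hΦ.eventually_analyticAt] with x hx
    have hpow := (hasDerivAt_pow (N + 1) x.1).smul_const
      (((N + 1).factorial : ℂ)⁻¹ • iteratedDeriv (N + 1) (fun s => Φ (s, x.2)) 0)
    refine ((hasDerivAt_left_of_analyticAt hx).differentiableAt.hasDerivAt.sub hpow).congr_deriv ?_
    rw [hiter, smul_smul, smul_smul, Nat.factorial_succ]
    have := Nat.cast_add_one_ne_zero (R := ℂ) N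
    congr 2
    push_cast
    field_simp

lemma eventually_eq_zero_of_iteratedDeriv_eq_zero [CompleteSpace F] {φ : ℂ → F} {t : ℂ}
    (hφ : AnalyticAt ℂ φ t) (h : ∀ j, iteratedDeriv j φ t = 0) : φ =ᶠ[𝓝 t] 0 := by
  refine analyticOrderAt_eq_top.1 (ENat.eq_top_iff_forall_ge.2 fun j => ?_)
  exact (natCast_le_analyticOrderAt_iff_iteratedDeriv_eq_zero hφ).2 fun i _ => h i

end Expansion

section Weighted

variable {V : Type*} [NormedAddCommGroup V] [NormedSpace ℂ V] {m : ℕ}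

/-- The weighted dilation `(z, w) ↦ (t z, tᵐ w)`. -/
def dilation (m : ℕ) (t : ℂ) (x : V × ℂ) : V × ℂ := (t • x.1, t ^ m * x.2)

/-- The pullback of the field `K` by the dilation with parameter `t`, multiplied by `tᵐ`; its Taylor
coefficients in `t` are the weighted homogeneous components of `K`. -/
def weightedFamily (m : ℕ) (K : V × ℂ → V × ℂ) (x : ℂ × (V × ℂ)) : V × ℂ :=
  (x.1 ^ (m - 1) • (K (dilation m x.1 x.2)).1, (K (dilation m x.1 x.2)).2)

/-- The component of order `j` of `K` in the weighted expansion. -/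
noncomputable def weightedComponent (m j : ℕ) (K : V × ℂ → V × ℂ) (x : V × ℂ) : V × ℂ :=
  (j.factorial : ℂ)⁻¹ • iteratedDeriv j (fun t => weightedFamily m K (t, x)) 0

lemma dilation_zero_left (hm : m ≠ 0) (x : V × ℂ) : dilation m 0 x = 0 := by
  simp [dilation, hm]

lemma dilation_dilation_inv {t : ℂ} (ht : t ≠ 0) (x : V × ℂ) :
    dilation m t (dilation m t⁻¹ x) = x := by
  ext <;> simp [dilation, smul_smul, ht]

lemma norm_dilation_le (hm : m ≠ 0) {t : ℂ} (ht : ‖t‖ ≤ 1) (x : V × ℂ) :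
    ‖dilation m t x‖ ≤ ‖t‖ * ‖x‖ := by
  refine max_le ((norm_smul_le _ _).trans (by gcongr; exact norm_fst_le x)) ?_
  rw [dilation, norm_mul, norm_pow]
  exact mul_le_mul (pow_le_of_le_one (norm_nonneg t) ht hm) (norm_snd_le x) (norm_nonneg _)
    (norm_nonneg _)

lemma norm_dilation_le_norm (hm : m ≠ 0) {t : ℂ} (ht : ‖t‖ ≤ 1) (x : V × ℂ) :
    ‖dilation m t x‖ ≤ ‖x‖ :=
  (norm_dilation_le hm ht x).trans (mul_le_of_le_one_left (norm_nonneg x) ht)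

lemma norm_weightedFamily_le {K : V × ℂ → V × ℂ} {t : ℂ} (ht : ‖t‖ ≤ 1) (x : V × ℂ) :
    ‖weightedFamily m K (t, x)‖ ≤ ‖K (dilation m t x)‖ := by
  refine max_le ((norm_smul_le _ _).trans ?_) (norm_snd_le (K (dilation m t x)))
  rw [norm_pow]
  exact (mul_le_of_le_one_left (norm_nonneg _) (pow_le_one₀ (norm_nonneg t) ht)).trans
    (norm_fst_le (K (dilation m t x)))

variable {K : V × ℂ → V × ℂ}

lemma analyticAt_weightedFamily {x : ℂ × (V × ℂ)} (hK : AnalyticAt ℂ K (dilation m x.1 x.2)) :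
    AnalyticAt ℂ (weightedFamily m K) x := by
  have hdil : AnalyticAt ℂ (fun x : ℂ × (V × ℂ) => dilation m x.1 x.2) x :=
    (analyticAt_fst.smul (analyticAt_fst.comp analyticAt_snd)).prod
      ((analyticAt_fst.pow m).mul (analyticAt_snd.comp analyticAt_snd))
  have hKdil := hK.comp (f := fun x : ℂ × (V × ℂ) => dilation m x.1 x.2) hdil
  exact ((analyticAt_fst.pow (m - 1)).smul (analyticAt_fst.comp hKdil)).prod
    (analyticAt_snd.comp hKdil)

lemma analyticAt_weightedFamily_zero_left (hm : m ≠ 0) (hK : AnalyticAt ℂ K 0) (x : V × ℂ) :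
    AnalyticAt ℂ (weightedFamily m K) (0, x) :=
  analyticAt_weightedFamily (by rwa [dilation_zero_left hm])

variable [CompleteSpace V]

lemma analyticOnNhd_weightedComponent (hm : m ≠ 0) (hK : AnalyticAt ℂ K 0) (j : ℕ) :
    AnalyticOnNhd ℂ (weightedComponent m j K) univ := fun x _ =>
  AnalyticAt.fun_const_smul (c := (j.factorial : ℂ)⁻¹) <|
    (analyticAt_iteratedDeriv_left (analyticAt_weightedFamily_zero_left hm hK x) j).comp
      (f := fun x => ((0 : ℂ), x)) (by fun_prop)

theorem weightedComponent_isBigO (hm : m ≠ 0) (hK : AnalyticAt ℂ K 0) {N : ℕ}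
    (hKN : K =O[𝓝 0] fun x => ‖x‖ ^ N) (j : ℕ) :
    weightedComponent m j K =O[𝓝 0] fun x => ‖x‖ ^ N := by
  obtain ⟨C, hC0, hC⟩ := hKN.exists_pos
  obtain ⟨ε, hε, hball⟩ :=
    Metric.eventually_nhds_iff_ball.1 (hC.bound.and hK.eventually_analyticAt)
  refine .of_bound C ?_
  filter_upwards [Metric.ball_mem_nhds 0 hε] with x hx
  have hmem {t : ℂ} (ht : ‖t‖ ≤ 1) : dilation m t x ∈ Metric.ball 0 ε :=
    mem_ball_zero_iff.2 ((norm_dilation_le_norm hm ht x).trans_lt (mem_ball_zero_iff.1 hx))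
  have hd : DiffContOnCl ℂ (fun t => weightedFamily m K (t, x)) (Metric.ball 0 1) := by
    refine DifferentiableOn.diffContOnCl fun t ht => ?_
    rw [closure_ball _ one_ne_zero, mem_closedBall_zero_iff] at ht
    exact (hasDerivAt_left_of_analyticAt (analyticAt_weightedFamily (x := (t, x))
      (hball _ (hmem ht)).2)).differentiableAt.differentiableWithinAt
  have hsphere (t : ℂ) (ht : t ∈ Metric.sphere 0 1) :
      ‖weightedFamily m K (t, x)‖ ≤ C * ‖x‖ ^ N := by
    have ht' : ‖t‖ ≤ 1 := (mem_sphere_zero_iff_norm.1 ht).le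
    refine (norm_weightedFamily_le ht' x).trans ((hball _ (hmem ht')).1.trans ?_)
    rw [norm_pow, norm_norm]
    gcongr
    exact norm_dilation_le_norm hm ht' x
  have hcauchy := norm_iteratedDeriv_le_of_forall_mem_sphere_norm_le j one_pos hd hsphere
  rw [one_pow, div_one] at hcauchy
  rw [weightedComponent, norm_smul, norm_inv, norm_natCast, norm_pow, norm_norm,
    inv_mul_le_iff₀ (by positivity)]
  exact hcauchy

theorem eventually_eq_zero_of_weightedComponent_eq_zero (hm : m ≠ 0) (hK : AnalyticAt ℂ K 0)
    (h : ∀ j, weightedComponent m j K = 0) : K =ᶠ[𝓝 0] 0 := by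
  obtain ⟨ε, hε, hball⟩ := Metric.eventually_nhds_iff_ball.1 hK.eventually_analyticAt
  filter_upwards [Metric.ball_mem_nhds 0 hε] with x hx
  have ha : AnalyticOnNhd ℂ (fun t => weightedFamily m K (t, x)) (Metric.closedBall 0 1) := by
    intro t ht
    refine (analyticAt_weightedFamily (hball _ ?_)).comp (f := fun t => (t, x)) (by fun_prop)
    exact mem_ball_zero_iff.2 ((norm_dilation_le_norm hm (mem_closedBall_zero_iff.1 ht) x).trans_lt
      (mem_ball_zero_iff.1 hx))
  have h0 := eventually_eq_zero_of_iteratedDeriv_eq_zero (ha 0 (by simp)) fun j =>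
    (smul_eq_zero.1 (congrFun (h j) x)).resolve_left (by simp [Nat.factorial_ne_zero])
  have h1 := ha.eqOn_zero_of_preconnected_of_eventuallyEq_zero
    (convex_closedBall _ _).isPreconnected (by simp) h0 (x := 1) (by simp)
  simpa [weightedFamily, dilation, Prod.ext_iff] using h1

end Weighted

section LeadingComponent

/-- The hypersurface `Im w = ψ(z, Re w)`. -/
def graph {V : Type*} (ψ : V × ℝ → ℝ) : Set (V × ℂ) := {p | p.2.im = ψ (p.1, p.2.re)}

/-- The point of `graph ψ` over `(z, u)`. -/
noncomputable def graphPoint {V : Type*} (ψ : V × ℝ → ℝ) (x : V × ℝ) : V × ℂ :=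
  (x.1, x.2 + I * ψ x)

lemma graphPoint_mem_graph {V : Type*} (ψ : V × ℝ → ℝ) (x : V × ℝ) :
    graphPoint ψ x ∈ graph ψ := by
  simp [graphPoint, graph]

lemma graphPoint_zero {V : Type*} [Zero V] {ψ : V × ℝ → ℝ} (hψ0 : ψ 0 = 0) :
    graphPoint ψ 0 = 0 := by
  simp [graphPoint, hψ0]

lemma graphPoint_add_mem_graph_iff {V : Type*} [Add V] (ψ : V × ℝ → ℝ) (x : V × ℝ) (k : V × ℂ) :
    graphPoint ψ x + k ∈ graph ψ ↔ k.2.im = ψ (x + (k.1, k.2.re)) - ψ x := by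
  simp [graphPoint, graph, eq_sub_iff_add_eq', ← Prod.mk_add_mk]

variable {V : Type*} [NormedAddCommGroup V] [NormedSpace ℂ V] {Q : V → ℝ} {r : V × ℝ → ℝ}
  {K : V × ℂ → V × ℂ} {m N : ℕ} {y : ℝ → V × ℂ} {p : V × ℂ}

lemma tendsto_weighted (hm : m ≠ 0) (z : V) (u : ℝ) :
    Tendsto (fun t : ℝ => (t • z, t ^ m * u)) (𝓝[≠] 0) (𝓝 0) :=
  ((by fun_prop : Continuous fun t : ℝ => (t • z, t ^ m * u)).tendsto' 0 0
    (by simp [hm])).mono_left nhdsWithin_le_nhds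

theorem tendsto_dilation_inv_graphPoint (hm : m ≠ 0) (hQ : ∀ (t : ℝ) z, Q (t • z) = t ^ m * Q z)
    (hr : r =o[𝓝 0] fun x => ‖x.1‖ ^ m + ‖x.2‖) (z : V) (u : ℝ) :
    Tendsto (fun t : ℝ => dilation m (t : ℂ)⁻¹ (graphPoint (fun x => Q x.1 + r x)
      (t • z, t ^ m * u))) (𝓝[≠] 0) (𝓝 (graphPoint (fun x => Q x.1) (z, u))) := by
  have hrt : Tendsto (fun t : ℝ => (t ^ m)⁻¹ • r (t • z, t ^ m * u)) (𝓝[≠] 0) (𝓝 0) := by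
    refine IsLittleO.tendsto_inv_smul_nhds_zero <|
      (hr.comp_tendsto (tendsto_weighted hm z u)).trans_isBigO <|
        .of_bound (‖z‖ ^ m + ‖u‖) <| .of_forall fun t => le_of_eq ?_
    simp only [Function.comp_apply, norm_smul, norm_mul, norm_pow, mul_pow, ← mul_add]
    rw [mul_comm, Real.norm_of_nonneg (add_nonneg (by positivity) (norm_nonneg u)), norm_norm]
  have hc : Continuous fun s : ℝ => (z, (u + I * (Q z + s : ℝ) : ℂ)) := by fun_prop
  refine ((hc.tendsto' 0 _ (by simp [graphPoint])).comp hrt).congr' ?_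
  filter_upwards [self_mem_nhdsWithin] with t ht
  have ht' : (t : ℂ) ≠ 0 := ofReal_ne_zero.2 ht
  ext
  · simp [dilation, graphPoint, ← Complex.coe_smul, smul_smul, ht']
  · simp only [Function.comp_apply, dilation, graphPoint, hQ, smul_eq_mul, inv_pow]
    push_cast
    field_simp

theorem tendsto_inv_pow_smul_weightedFamily [CompleteSpace V] (hm : m ≠ 0) (hK : AnalyticAt ℂ K 0)
    (hN : ∀ j < N, weightedComponent m j K = 0) (hy : Tendsto y (𝓝[≠] 0) (𝓝 p)) :
    Tendsto (fun t : ℝ => (t ^ N)⁻¹ • weightedFamily m K (t, y t)) (𝓝[≠] 0)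
      (𝓝 (weightedComponent m N K p)) := by
  have hty : Tendsto (fun t : ℝ => ((t : ℂ), y t)) (𝓝[≠] 0) (𝓝 (0, p)) :=
    ((continuous_ofReal.tendsto' 0 0 ofReal_zero).mono_left nhdsWithin_le_nhds).prodMk_nhds hy
  have hlt : ∀ j < N, ∀ x, iteratedDeriv j (fun s => weightedFamily m K (s, x)) 0 = 0 :=
    fun j hj x => by
      simpa [weightedComponent, Nat.cast_ne_zero.2 j.factorial_ne_zero] using congrFun (hN j hj) x
  have hlead := ((sub_pow_smul_iteratedDeriv_isLittleO
    (analyticAt_weightedFamily_zero_left hm hK p) hlt).comp_tendsto hty).tendsto_inv_smul_nhds_zero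
  have hlim := hlead.add
    ((analyticOnNhd_weightedComponent hm hK N p trivial).continuousAt.tendsto.comp hy)
  rw [zero_add] at hlim
  refine hlim.congr' ?_
  filter_upwards [self_mem_nhdsWithin] with t ht
  have ht' : (t : ℂ) ^ N ≠ 0 := pow_ne_zero N (ofReal_ne_zero.2 ht)
  simp only [Function.comp_apply, weightedComponent, smul_sub, inv_smul_smul₀ ht', sub_add_cancel]
  rw [← Complex.coe_smul]
  push_cast
  rfl

theorem weightedFamily_isBigO [CompleteSpace V] (hm : m ≠ 0) (hK : AnalyticAt ℂ K 0)
    (hN : ∀ j < N, weightedComponent m j K = 0) (hy : Tendsto y (𝓝[≠] 0) (𝓝 p)) :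
    (fun t : ℝ => weightedFamily m K (t, y t)) =O[𝓝[≠] 0] fun t => t ^ N := by
  have h := (isBigO_refl (fun t : ℝ => t ^ N) (𝓝[≠] 0)).smul
    ((tendsto_inv_pow_smul_weightedFamily hm hK hN hy).isBigO_one ℝ)
  simp only [smul_eq_mul, mul_one] at h
  refine h.congr' ?_ .rfl
  filter_upwards [self_mem_nhdsWithin] with t ht
  exact smul_inv_smul₀ (pow_ne_zero N ht) _

lemma dilation_isBigO (hm : m ≠ 0) (hy : Tendsto y (𝓝[≠] 0) (𝓝 p)) :
    (fun t : ℝ => dilation m t (y t)) =O[𝓝[≠] 0] fun t => t := by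
  have h : (fun t : ℝ => dilation m t (y t)) =O[𝓝[≠] 0] fun t => ‖t‖ * ‖y t‖ := by
    refine .of_norm_eventuallyLE ?_
    have h1 : ∀ᶠ t : ℝ in 𝓝[≠] 0, ‖t‖ ≤ 1 :=
      ((continuous_norm.tendsto' (0 : ℝ) 0 norm_zero).mono_left
        nhdsWithin_le_nhds).eventually_le_const one_pos
    filter_upwards [h1] with t ht
    simpa using norm_dilation_le hm (by simpa using ht : ‖(t : ℂ)‖ ≤ 1) (y t)
  simpa using h.trans ((isBigO_refl _ _).norm_left.mul (hy.norm.isBigO_one ℝ))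

lemma comp_dilation_isLittleO (hm : m ≠ 0) (hKo : K =o[𝓝 0] fun x => x)
    (hy : Tendsto y (𝓝[≠] 0) (𝓝 p)) :
    (fun t : ℝ => K (dilation m t (y t))) =o[𝓝[≠] 0] fun t => t :=
  have hd := dilation_isBigO hm hy
  (hKo.comp_tendsto (hd.trans_tendsto nhdsWithin_le_nhds)).trans_isBigO hd

theorem sub_isLittleO_pow_along_dilation [CompleteSpace V] (hm : m ≠ 0) (hK : AnalyticAt ℂ K 0)
    (hKo : K =o[𝓝 0] fun x => x) (hN : ∀ j < N, weightedComponent m j K = 0)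
    (hr : (fun q : (V × ℝ) × (V × ℝ) => r q.1 - r q.2) =O[𝓝 0] weightedModulus m)
    (hy : Tendsto y (𝓝[≠] 0) (𝓝 p)) (z : V) (u : ℝ) :
    (fun t : ℝ => r ((t • z, t ^ m * u) + ((K (dilation m t (y t))).1,
      (K (dilation m t (y t))).2.re)) - r (t • z, t ^ m * u)) =o[𝓝[≠] 0] fun t => t ^ N := by
  have ht : Tendsto (fun t : ℝ => t) (𝓝[≠] 0) (𝓝 0) := nhdsWithin_le_nhds
  have hk := (comp_dilation_isLittleO hm hKo hy).isBigO
  have hx := tendsto_weighted hm z u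
  have hh : Tendsto (fun t : ℝ => ((K (dilation m t (y t))).1, (K (dilation m t (y t))).2.re))
      (𝓝[≠] 0) (𝓝 0) :=
    ((by fun_prop : Continuous fun a : V × ℂ => (a.1, a.2.re)).tendsto' 0 0 rfl).comp
      (hk.trans_tendsto ht)
  have hW := weightedFamily_isBigO hm hK hN hy
  have hk1 : (fun t : ℝ => t ^ (m - 1) * ‖(K (dilation m t (y t))).1‖) =O[𝓝[≠] 0]
      fun t => t ^ N :=
    (isBigO_of_le _ fun t => by simp [norm_smul]).trans hW.prod_left_fst
  have hk2 : (fun t : ℝ => (K (dilation m t (y t))).2.re) =O[𝓝[≠] 0] fun t => t ^ N :=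
    (isBigO_of_le _ fun t => abs_re_le_norm _).trans hW.prod_left_snd
  have hq := (hx.add hh).prodMk_nhds hx
  rw [zero_add, ← Prod.zero_eq_mk] at hq
  refine (hr.comp_tendsto hq).trans_isLittleO <| weightedModulus_add_isLittleO hm ht hx hh
    (.of_bound ‖z‖ <| .of_forall fun t => ?_) (.of_bound ‖u‖ <| .of_forall fun t => ?_)
    hk.prod_left_fst hk1 hk2
  · rw [norm_smul, mul_comm]
  · rw [norm_mul, mul_comm]

theorem tendsto_sub_along_dilation [CompleteSpace V] (hm : m ≠ 0) (hK : AnalyticAt ℂ K 0)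
    (hKo : K =o[𝓝 0] fun x => x) (hN : ∀ j < N, weightedComponent m j K = 0)
    (hQ : ∀ (t : ℝ) z, Q (t • z) = t ^ m * Q z) (hQd : Differentiable ℝ Q)
    (hy : Tendsto y (𝓝[≠] 0) (𝓝 p)) (z : V) :
    Tendsto (fun t : ℝ => (t ^ N)⁻¹ • (Q (t • z + (K (dilation m t (y t))).1) - Q (t • z)))
      (𝓝[≠] 0) (𝓝 (fderiv ℝ Q z (weightedComponent m N K p).1)) := by
  have hd : Tendsto (fun t : ℝ => t⁻¹ • (K (dilation m t (y t))).1) (𝓝[≠] 0) (𝓝 0) :=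
    (comp_dilation_isLittleO hm hKo hy).prod_left_fst.tendsto_inv_smul_nhds_zero
  have hcd : Tendsto (fun t : ℝ => ((t ^ N)⁻¹ * t ^ m) • t⁻¹ • (K (dilation m t (y t))).1)
      (𝓝[≠] 0) (𝓝 (weightedComponent m N K p).1) := by
    refine ((continuous_fst.tendsto _).comp
      (tendsto_inv_pow_smul_weightedFamily hm hK hN hy)).congr' ?_
    filter_upwards [self_mem_nhdsWithin] with t ht
    rw [Function.comp_apply, weightedFamily, Prod.smul_fst, ← ofReal_pow, Complex.coe_smul,
      smul_smul, smul_smul, ← pow_sub_one_mul hm t, mul_assoc, mul_assoc, mul_inv_cancel₀ ht,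
      mul_one]
  refine ((hQd z).hasFDerivAt.hasFDerivWithinAt (s := univ) |>.lim hd (by simp) hcd).congr' ?_
  filter_upwards [self_mem_nhdsWithin] with t ht
  have hz : t • z + (K (dilation m t (y t))).1 = t • (z + t⁻¹ • (K (dilation m t (y t))).1) := by
    rw [smul_add, smul_inv_smul₀ ht]
  rw [hz, hQ, hQ, ← mul_sub, smul_eq_mul, smul_eq_mul, mul_assoc]

/-- Compare the terms of order `tᴺ` in the equation of the hypersurface at the images of the points
over `(t z, tᵐ u)`. -/
theorem im_weightedComponent_eq [CompleteSpace V] (hm : m ≠ 0) (hK : AnalyticAt ℂ K 0)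
    (hKo : K =o[𝓝 0] fun x => x) (hN : ∀ j < N, weightedComponent m j K = 0)
    (hQ : ∀ (t : ℝ) z, Q (t • z) = t ^ m * Q z) (hQd : Differentiable ℝ Q) (hr0 : r 0 = 0)
    (hr : (fun q : (V × ℝ) × (V × ℝ) => r q.1 - r q.2) =O[𝓝 0] weightedModulus m)
    (hinv : ∀ᶠ p in 𝓝 0, p ∈ graph (fun x => Q x.1 + r x) →
      p + K p ∈ graph (fun x => Q x.1 + r x)) (z : V) (u : ℝ) :
    (weightedComponent m N K (graphPoint (fun x => Q x.1) (z, u))).2.im =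
      fderiv ℝ Q z (weightedComponent m N K (graphPoint (fun x => Q x.1) (z, u))).1 := by
  have hy := tendsto_dilation_inv_graphPoint hm hQ
    (isLittleO_of_isBigO_weightedModulus hr hr0) z u
  set y : ℝ → V × ℂ := fun t => dilation m (t : ℂ)⁻¹
    (graphPoint (fun x => Q x.1 + r x) (t • z, t ^ m * u))
  have him : Tendsto (fun t : ℝ => (t ^ N)⁻¹ • (K (dilation m t (y t))).2.im) (𝓝[≠] 0)
      (𝓝 (weightedComponent m N K (graphPoint (fun x => Q x.1) (z, u))).2.im) :=
    ((by fun_prop : Continuous fun a : V × ℂ => a.2.im).tendsto _ |>.comp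
      (tendsto_inv_pow_smul_weightedFamily hm hK hN hy)).congr fun t => by
        simp only [Function.comp_apply, Prod.smul_snd, Complex.smul_im]; rfl
  have hlim := (tendsto_sub_along_dilation hm hK hKo hN hQ hQd hy z).add
    (sub_isLittleO_pow_along_dilation hm hK hKo hN hr hy z u).tendsto_inv_smul_nhds_zero
  rw [add_zero] at hlim
  refine tendsto_nhds_unique him (hlim.congr' ?_)
  have hp0 : Tendsto (fun t : ℝ => dilation m t (y t)) (𝓝[≠] 0) (𝓝 0) :=
    (dilation_isBigO hm hy).trans_tendsto nhdsWithin_le_nhds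
  filter_upwards [self_mem_nhdsWithin, hp0.eventually hinv] with t ht hi
  have hp : dilation m t (y t) = graphPoint (fun x => Q x.1 + r x) (t • z, t ^ m * u) :=
    dilation_dilation_inv (ofReal_ne_zero.2 ht) _
  have himage := hi (hp ▸ graphPoint_mem_graph _ _)
  nth_rw 1 [hp] at himage
  rw [graphPoint_add_mem_graph_iff] at himage
  rw [← smul_add]
  congr 1
  rw [himage, Prod.mk_add_mk]
  ring

end LeadingComponent

section Reflection

theorem eventually_eq_of_hasStrictFDerivAt {E : Type*} [NormedAddCommGroup E] [NormedSpace ℝ E]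
    {σ : E → ℝ} {T : E →L[ℝ] ℝ} {x e : E} (hσ : HasStrictFDerivAt σ T x) (he : T e ≠ 0) :
    ∀ᶠ q in 𝓝 (x, x), ∀ s : ℝ, q.1 - q.2 = s • e → σ q.1 = σ q.2 → q.1 = q.2 := by
  have he0 : 0 < ‖e‖ := norm_pos_iff.2 fun h => he (by rw [h, map_zero])
  have hc : 0 < ‖T e‖ / (2 * ‖e‖) := by have := norm_pos_iff.2 he; positivity
  filter_upwards [hσ.isLittleO.bound hc] with q hq s hs hσq
  rw [hσq, hs, sub_self, zero_sub, norm_neg, map_smul, norm_smul, norm_smul] at hq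
  have hs0 : ‖s‖ * ‖T e‖ ≤ 0 := by
    have : ‖T e‖ / (2 * ‖e‖) * (‖s‖ * ‖e‖) = ‖s‖ * ‖T e‖ / 2 := by field_simp
    linarith
  have : s = 0 := by
    simpa [he] using le_antisymm hs0 (by positivity)
  rwa [this, zero_smul, sub_eq_zero] at hs

variable {V : Type*} [NormedAddCommGroup V] [NormedSpace ℝ V] {ψ : V × ℝ → ℝ} {σ : V × ℂ → ℝ}
  {T : V × ℂ →L[ℝ] ℝ}

lemma hasFDerivAt_graphPoint (hψ : HasFDerivAt ψ (0 : V × ℝ →L[ℝ] ℝ) 0) :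
    HasFDerivAt (graphPoint ψ) ((ContinuousLinearMap.id ℝ V).prodMap ofRealCLM) 0 := by
  have hI : HasFDerivAt (fun x => I * (ψ x : ℂ)) (0 : V × ℝ →L[ℝ] ℂ) 0 :=
    ((ofRealCLM.hasFDerivAt.comp 0 hψ).const_mul I).congr_fderiv (by ext <;> simp)
  refine (hasFDerivAt_fst.prodMk
    ((ofRealCLM.hasFDerivAt.comp (0 : V × ℝ) hasFDerivAt_snd).add hI)).congr_fderiv ?_
  ext <;> simp

/-- As `ψ` vanishes to second order, `T` vanishes on `V × ℝ`, so it does not vanish at `(0, i)`, the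
direction in which a point is projected to the hypersurface. -/
theorem eventually_mem_graph_of_eq_zero (hψ : HasFDerivAt ψ (0 : V × ℝ →L[ℝ] ℝ) 0) (hψ0 : ψ 0 = 0)
    (hσ : HasStrictFDerivAt σ T 0) (hT : T ≠ 0) (h : ∀ᶠ p in 𝓝 0, p ∈ graph ψ → σ p = 0) :
    ∀ᶠ p in 𝓝 0, σ p = 0 → p ∈ graph ψ := by
  have hg := hasFDerivAt_graphPoint hψ
  have hg0 := graphPoint_zero hψ0
  have hgt : Tendsto (graphPoint ψ) (𝓝 0) (𝓝 0) := by simpa [hg0] using hg.continuousAt.tendsto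
  have hσg : ∀ᶠ x in 𝓝 0, σ (graphPoint ψ x) = 0 :=
    (hgt.eventually h).mono fun x hx => hx (graphPoint_mem_graph ψ x)
  have hTreal (ζ : V) (s : ℝ) : T (ζ, (s : ℂ)) = 0 := by
    have hzero := ((hasFDerivAt_const (0 : ℝ) (0 : V × ℝ)).congr_of_eventuallyEq hσg).unique
      (HasFDerivAt.comp (0 : V × ℝ) (hg0 ▸ hσ.hasFDerivAt) hg)
    simpa using (DFunLike.congr_fun hzero (ζ, s)).symm
  have hTI : T (0, I) ≠ 0 := fun h0 => hT <| ContinuousLinearMap.ext fun p => by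
    have hp : p = (p.1, (p.2.re : ℂ)) + p.2.im • (0, I) := by ext <;> simp
    rw [hp, map_add, map_smul, hTreal, h0, smul_zero, add_zero, zero_apply]
  have hproj : Tendsto (fun p : V × ℂ => (p, graphPoint ψ (p.1, p.2.re))) (𝓝 0) (𝓝 (0, 0)) :=
    tendsto_id.prodMk_nhds <| hgt.comp <|
      (by fun_prop : Continuous fun p : V × ℂ => (p.1, p.2.re)).tendsto' 0 0 rfl
  have hσproj : ∀ᶠ p : V × ℂ in 𝓝 0, σ (graphPoint ψ (p.1, p.2.re)) = 0 :=
    ((by fun_prop : Continuous fun p : V × ℂ => (p.1, p.2.re)).tendsto' 0 0 rfl).eventually hσg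
  filter_upwards [hproj.eventually (eventually_eq_of_hasStrictFDerivAt hσ hTI), hσproj]
    with p hp hp' hσp
  have hsub : p - graphPoint ψ (p.1, p.2.re) = (p.2.im - ψ (p.1, p.2.re)) • (0, I) := by
    ext
    · simp [graphPoint]
    · simp only [graphPoint, Prod.snd_sub, Prod.smul_snd, real_smul]
      push_cast
      linear_combination -re_add_im p.2
  rw [hp _ hsub (hσp.trans hp'.symm)]
  exact graphPoint_mem_graph ψ _

theorem eventually_mem_graph_of_map_mem_graph
    (hψ : HasStrictFDerivAt ψ (0 : V × ℝ →L[ℝ] ℝ) 0) (hψ0 : ψ 0 = 0) {F : V × ℂ → V × ℂ}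
    {A : V × ℂ →L[ℝ] V × ℂ} (hF : HasStrictFDerivAt F A 0) (hF0 : F 0 = 0)
    (hA : Function.Surjective A) (hFM : ∀ᶠ p in 𝓝 0, p ∈ graph ψ → F p ∈ graph ψ) :
    ∀ᶠ p in 𝓝 0, F p ∈ graph ψ → p ∈ graph ψ := by
  have hρ : HasStrictFDerivAt (fun p : V × ℂ => p.2.im - ψ (p.1, p.2.re))
      (imCLM ∘L .snd ℝ V ℂ) 0 := by
    have hψ' : HasStrictFDerivAt ψ (0 : V × ℝ →L[ℝ] ℝ) ((0 : V × ℂ).1, (0 : V × ℂ).2.re) := hψ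
    have hψp := hψ'.comp (0 : V × ℂ)
      (hasStrictFDerivAt_fst.prodMk (reCLM ∘L .snd ℝ V ℂ).hasStrictFDerivAt)
    exact ((imCLM ∘L .snd ℝ V ℂ).hasStrictFDerivAt.sub hψp).congr_fderiv (by simp)
  have hσ := HasStrictFDerivAt.comp (0 : V × ℂ) (hF0.symm ▸ hρ) hF
  have hT : (imCLM ∘L .snd ℝ V ℂ) ∘L A ≠ 0 := fun h => by
    obtain ⟨v, hv⟩ := hA (0, I)
    simpa [hv] using DFunLike.congr_fun h v
  have hmem (p : V × ℂ) : p.2.im - ψ (p.1, p.2.re) = 0 ↔ p ∈ graph ψ := sub_eq_zero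
  simpa only [Function.comp_apply, hmem] using
    eventually_mem_graph_of_eq_zero hψ.hasFDerivAt hψ0 hσ hT
      (by simpa only [Function.comp_apply, hmem] using hFM)

end Reflection

section Perturbation

variable {V E : Type*} [NormedAddCommGroup V] [NormedSpace ℂ V]
  [NormedAddCommGroup E] [InnerProductSpace ℂ E] {p : V → E} {d : ℕ}

lemma hasFDerivAt_norm_sq_complex {p' : V →L[ℂ] E} {z : V} (hp : HasFDerivAt p p' z) :
    HasFDerivAt (fun z => ‖p z‖ ^ 2)
      ((2 : ℝ) • reCLM ∘L (innerSL ℂ (p z) ∘L p').restrictScalars ℝ) z := by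
  have hinner := reCLM.hasFDerivAt.comp z
    ((hp.restrictScalars ℝ).inner ℂ (hp.restrictScalars ℝ))
  refine (hinner.congr_fderiv ?_).congr_of_eventuallyEq <|
    .of_forall fun x => (inner_self_eq_norm_sq (𝕜 := ℂ) (p x)).symm
  ext ξ
  have := inner_re_symm (𝕜 := ℂ) (p' ξ) (p z)
  simp only [RCLike.re_to_complex] at this
  simp [this, two_mul]

lemma norm_sq_real_smul (hom : ∀ (c : ℂ) z, p (c • z) = c ^ d • p z) (t : ℝ) (z : V) :
    ‖p (t • z)‖ ^ 2 = t ^ (2 * d) * ‖p z‖ ^ 2 := by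
  rw [← Complex.coe_smul, hom, norm_smul, mul_pow, norm_pow, norm_real, Real.norm_eq_abs, ← pow_mul,
    mul_comm d, (even_two_mul d).pow_abs]

lemma isInfinitesimalAutomorphism_of_im_eq (hp : Differentiable ℂ p) {X : V × ℂ → V × ℂ}
    (h : ∀ z (u : ℝ), (X (graphPoint (fun x => ‖p x.1‖ ^ 2) (z, u))).2.im =
      fderiv ℝ (fun z => ‖p z‖ ^ 2) z (X (graphPoint (fun x => ‖p x.1‖ ^ 2) (z, u))).1) :
    IsInfinitesimalAutomorphism p X := fun z u => by
  have := h z u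
  rw [(hasFDerivAt_norm_sq_complex (hp z).hasFDerivAt).fderiv] at this
  simp only [graphPoint, ofReal_pow] at this
  simp [tangencyForm, this]

/-- By `im_weightedComponent_eq`, the first nonzero weighted component of `K` would be an
infinitesimal automorphism of the model vanishing to third order at the origin. -/
theorem eventually_eq_zero_of_preserves_graph [CompleteSpace V] [CompleteSpace E] (hd : d ≠ 0)
    (hp : AnalyticOnNhd ℂ p univ) (hom : ∀ (c : ℂ) z, p (c • z) = c ^ d • p z) (hne : p ≠ 0)
    (hnondeg : ∀ X : V × ℂ → V × ℂ, AnalyticOnNhd ℂ X univ →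
      (∀ x, (X x).2 = 0 ∧ fderiv ℂ p x.1 (X x).1 = 0) → X = 0)
    {r : V × ℝ → ℝ} (hr0 : r 0 = 0)
    (hr : (fun q : (V × ℝ) × (V × ℝ) => r q.1 - r q.2) =O[𝓝 0] weightedModulus (2 * d))
    {K : V × ℂ → V × ℂ} (hK : AnalyticAt ℂ K 0) (hK3 : K =O[𝓝 0] fun x => ‖x‖ ^ 3)
    (hinv : ∀ᶠ x in 𝓝 0, x ∈ graph (fun x => ‖p x.1‖ ^ 2 + r x) →
      x + K x ∈ graph (fun x => ‖p x.1‖ ^ 2 + r x)) :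
    K =ᶠ[𝓝 0] 0 := by
  have hm : 2 * d ≠ 0 := mul_ne_zero two_ne_zero hd
  have hKo : K =o[𝓝 0] fun x => x :=
    hK3.trans_isLittleO (isLittleO_norm_pow_id (by norm_num))
  refine eventually_eq_zero_of_weightedComponent_eq_zero hm hK fun N => ?_
  induction N using Nat.strong_induction_on with
  | _ N hN =>
    have hX := analyticOnNhd_weightedComponent hm hK N
    have hpd : Differentiable ℂ p := fun z => (hp z trivial).differentiableAt
    have haut : IsInfinitesimalAutomorphism p (weightedComponent (2 * d) N K) :=
      isInfinitesimalAutomorphism_of_im_eq hpd <|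
        im_weightedComponent_eq (Q := fun z => ‖p z‖ ^ 2) hm hK hKo hN (norm_sq_real_smul hom)
          (fun z => (hasFDerivAt_norm_sq_complex (hpd z).hasFDerivAt).differentiableAt) hr0 hr hinv
    exact hnondeg _ hX <|
      haut.annihilates hd hp hom (fun x => (hX x trivial).differentiableAt)
        (weightedComponent_isBigO hm hK hK3 N) hne

end Perturbation

section SumOfSquares

variable {n k d : ℕ} {P : Fin k → MvPolynomial (Fin n) ℂ}

/-- The map `z ↦ (P₁(z), …, Pₖ(z))`, with values in a Hermitian space so that its squared norm is
`sumOfSquares P`. -/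
noncomputable def polyMap (P : Fin k → MvPolynomial (Fin n) ℂ) (z : Fin n → ℂ) :
    EuclideanSpace ℂ (Fin k) :=
  WithLp.toLp 2 fun l => MvPolynomial.eval z (P l)

lemma norm_polyMap_sq (P : Fin k → MvPolynomial (Fin n) ℂ) (z : Fin n → ℂ) :
    ‖polyMap P z‖ ^ 2 = sumOfSquares P z :=
  EuclideanSpace.norm_sq_eq _

lemma analyticOnNhd_polyMap (P : Fin k → MvPolynomial (Fin n) ℂ) :
    AnalyticOnNhd ℂ (polyMap P) univ := fun z _ =>
  ((PiLp.continuousLinearEquiv 2 ℂ fun _ : Fin k => ℂ).symm.analyticAt _).comp <|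
    analyticAt_pi_iff.2 fun l => AnalyticOnNhd.eval_mvPolynomial (P l) z trivial

lemma differentiable_polyMap (P : Fin k → MvPolynomial (Fin n) ℂ) :
    Differentiable ℂ (polyMap P) :=
  fun z => (analyticOnNhd_polyMap P z trivial).differentiableAt

lemma polyMap_smul (hP : ∀ l, (P l).IsHomogeneous d) (c : ℂ) (z : Fin n → ℂ) :
    polyMap P (c • z) = c ^ d • polyMap P z := by
  ext l
  simp only [polyMap, PiLp.smul_apply, Pi.smul_apply, smul_eq_mul, MvPolynomial.eval_eq',
    Finset.mul_sum]
  refine Finset.sum_congr rfl fun s hs => ?_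
  have hdeg : ∑ i, s i = d := by
    simpa [Finsupp.weight_apply, Finsupp.sum_fintype] using
      hP l (MvPolynomial.mem_support_iff.1 hs)
  simp only [mul_pow, Finset.prod_mul_distrib, Finset.prod_pow_eq_pow_sum, hdeg]
  ring

lemma polyMap_ne_zero (hQ : sumOfSquares P ≠ 0) : polyMap P ≠ 0 := by
  intro hP
  exact hQ (funext fun z => by simp [← norm_polyMap_sq, hP])

lemma contDiff_sumOfSquares (P : Fin k → MvPolynomial (Fin n) ℂ) :
    ContDiff ℝ ∞ (sumOfSquares P) :=
  ContDiff.sum fun l _ => ContDiff.norm_sq ℝ <| contDiff_iff_contDiffAt.2 fun z =>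
    (AnalyticOnNhd.eval_mvPolynomial (P l) z trivial).contDiffAt.restrict_scalars ℝ

lemma fderiv_sumOfSquares (P : Fin k → MvPolynomial (Fin n) ℂ) (z ξ : Fin n → ℂ) :
    fderiv ℝ (sumOfSquares P) z ξ = 2 * (⟪polyMap P z, fderiv ℂ (polyMap P) z ξ⟫_ℂ).re := by
  rw [← funext (norm_polyMap_sq P),
    (hasFDerivAt_norm_sq_complex (differentiable_polyMap P z).hasFDerivAt).fderiv]
  simp

lemma fderiv_modelDefiningFunction {Q : (Fin n → ℂ) → ℝ} {q : Cn1 n}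
    (hQ : DifferentiableAt ℝ Q q.1) (v : Cn1 n) :
    fderiv ℝ (modelDefiningFunction Q) q v = v.2.im - fderiv ℝ Q q.1 v.1 := by
  have h : HasFDerivAt (modelDefiningFunction Q) _ q :=
    (imCLM ∘L .snd ℝ (Fin n → ℂ) ℂ).hasFDerivAt.sub (hQ.hasFDerivAt.comp q hasFDerivAt_fst)
  rw [h.fderiv]
  simp

/-- A holomorphic field annihilating all the `Pₗ` is tangent to the model. -/
theorem eq_zero_of_annihilates
    (hnondeg : HolomorphicallyNondegenerateAt (modelDefiningFunction (sumOfSquares P)) 0)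
    {X : Cn1 n → Cn1 n} (hX : AnalyticOnNhd ℂ X univ)
    (h : ∀ x, (X x).2 = 0 ∧ fderiv ℂ (polyMap P) x.1 (X x).1 = 0) : X = 0 := by
  have hρ (q v : Cn1 n) := fderiv_modelDefiningFunction (q := q)
    ((contDiff_sumOfSquares P).differentiable (by simp) q.1) v
  have hX0 : X =ᶠ[𝓝 0] 0 := hnondeg X
    ⟨hX 0 trivial, .of_forall fun q _ => by simp [hρ, fderiv_sumOfSquares, h]⟩
  exact hX.eq_of_eventuallyEq (fun _ _ => analyticAt_const) hX0

end SumOfSquares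

section Automorphism

variable {n m k d : ℕ} {M : Set (Cn1 n)} {F F' G : Cn1 n → Cn1 n} {ψ : (Fin n → ℂ) × ℝ → ℝ}

lemma IsLocalAutomorphism.tendsto (hF : IsLocalAutomorphism M F) : Tendsto F (𝓝 0) (𝓝 0) := by
  simpa only [hF.2.1] using hF.1.continuousAt.tendsto

lemma IsLocalAutomorphism.congr_set {M' : Set (Cn1 n)} (hF : IsLocalAutomorphism M F)
    (h : ∀ᶠ p in 𝓝 0, p ∈ M ↔ p ∈ M') : IsLocalAutomorphism M' F := by
  refine ⟨hF.1, hF.2.1, hF.2.2.1, ?_⟩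
  filter_upwards [hF.2.2.2, h, hF.tendsto.eventually h] with p hp hpM hFpM hpM'
  exact hFpM.1 (hp (hpM.2 hpM'))

lemma IsLocalAutomorphism.comp (hF : IsLocalAutomorphism M F) (hG : IsLocalAutomorphism M G) :
    IsLocalAutomorphism M (F ∘ G) := by
  have hGt := hG.tendsto
  obtain ⟨hFa, hF0, ⟨F', hF'a, hF'0, hF'F, hFF'⟩, hFM⟩ := hF
  obtain ⟨hGa, hG0, ⟨G', hG'a, hG'0, hG'G, hGG'⟩, hGM⟩ := hG
  have hF't : Tendsto F' (𝓝 0) (𝓝 0) := by simpa only [hF'0] using hF'a.continuousAt.tendsto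
  refine ⟨.comp (by rwa [hG0]) hGa, by simp [hF0, hG0],
    ⟨G' ∘ F', .comp (by rwa [hF'0]) hF'a, by simp [hF'0, hG'0], ?_, ?_⟩, ?_⟩
  · filter_upwards [hG'G, hGt.eventually hF'F] with p hp hGp
    rw [Function.comp_apply, Function.comp_apply, hGp, hp]
  · filter_upwards [hFF', hF't.eventually hGG'] with p hp hF'p
    rw [Function.comp_apply, Function.comp_apply, hF'p, hp]
  · filter_upwards [hGM, hGt.eventually hFM] with p hp hGp hpM using hGp (hp hpM)

lemma surjective_of_comp_eventuallyEq_id {E E' : Type*} [NormedAddCommGroup E] [NormedSpace ℂ E]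
    [NormedAddCommGroup E'] [NormedSpace ℂ E'] {f : E → E'} {g : E' → E} {A : E →L[ℂ] E'} {x : E'}
    (hf : HasFDerivAt f A (g x)) (hg : DifferentiableAt ℂ g x) (h : f ∘ g =ᶠ[𝓝 x] id) :
    Function.Surjective A := fun y => by
  have hid := (hf.comp x hg.hasFDerivAt).unique ((hasFDerivAt_id x).congr_of_eventuallyEq h)
  exact ⟨fderiv ℂ g x y, DFunLike.congr_fun hid y⟩

theorem IsLocalAutomorphism.exists_inverse (hψ : HasStrictFDerivAt ψ (0 : _ →L[ℝ] ℝ) 0)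
    (hψ0 : ψ 0 = 0) (hF : IsLocalAutomorphism (graph ψ) F) :
    ∃ F', IsLocalAutomorphism (graph ψ) F' ∧ F' ∘ F =ᶠ[𝓝 0] id ∧ F ∘ F' =ᶠ[𝓝 0] id := by
  obtain ⟨hFa, hF0, ⟨F', hF'a, hF'0, hF'F, hFF'⟩, hFM⟩ := hF
  have hsurj : Function.Surjective ((fderiv ℂ F 0).restrictScalars ℝ) :=
    surjective_of_comp_eventuallyEq_id (hF'0.symm ▸ hFa.differentiableAt.hasFDerivAt)
      hF'a.differentiableAt hFF'
  have hback := eventually_mem_graph_of_map_mem_graph hψ hψ0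
    (hFa.hasStrictFDerivAt.restrictScalars ℝ) hF0 hsurj hFM
  refine ⟨F', ⟨hF'a, hF'0, ⟨F, hFa, hF0, hFF', hF'F⟩, ?_⟩, hF'F, hFF'⟩
  have hF't : Tendsto F' (𝓝 0) (𝓝 0) := by simpa only [hF'0] using hF'a.continuousAt.tendsto
  filter_upwards [hF't.eventually hback, hFF'] with p hp hFF'p hpM
  exact hp (hFF'p.symm ▸ hpM)

theorem SameJet.isBigO_sub {j : ℕ} (h : SameJet j F G 0) (hF : AnalyticAt ℂ F 0)
    (hG : AnalyticAt ℂ G 0) : (fun p => G p - F p) =O[𝓝 0] fun p => ‖p‖ ^ (j + 1) := by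
  refine isBigO_pow_of_iteratedFDeriv_eq_zero (𝕜 := ℂ) (hG.sub hF).contDiffAt fun i hi => ?_
  refine (iteratedFDeriv_sub_apply (i := i) hG.contDiffAt hF.contDiffAt).trans ?_
  rw [h i (Nat.lt_succ_iff.1 hi), sub_self]

lemma comp_sub_self_isBigO_sub (hF' : AnalyticAt ℂ F' 0) (hF : Tendsto F (𝓝 0) (𝓝 0))
    (hG : Tendsto G (𝓝 0) (𝓝 0)) (h : F' ∘ F =ᶠ[𝓝 0] id) :
    (fun p => (F' ∘ G) p - p) =O[𝓝 0] fun p => G p - F p := by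
  refine (hF'.hasStrictFDerivAt.isBigO_sub.comp_tendsto (hG.prodMk_nhds hF)).congr' ?_ .rfl
  filter_upwards [h] with p hp
  exact congrArg (F' (G p) - ·) hp

lemma IsSmoothPerturbation.exists_remainder {Q : (Fin n → ℂ) → ℝ} (hQ : ContDiff ℝ ∞ Q)
    (hM : IsSmoothPerturbation m Q M) :
    ∃ r : (Fin n → ℂ) × ℝ → ℝ, ContDiffAt ℝ ∞ r 0 ∧ WeightedDerivativesVanish m r ∧
      ∀ᶠ p in 𝓝 0, p ∈ M ↔ p ∈ graph fun x => Q x.1 + r x := by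
  obtain ⟨ψ, ⟨U, hU, h0U, hψU⟩, hW, hMψ⟩ := hM
  refine ⟨fun x => ψ x - Q x.1, ?_, hW, ?_⟩
  · exact (hψU.contDiffAt (hU.mem_nhds h0U)).sub (hQ.comp contDiff_fst).contDiffAt
  · simpa only [add_sub_cancel, graph, Set.mem_ofPred_eq] using hMψ

lemma WeightedDerivativesVanish.hasStrictFDerivAt_zero {r : (Fin n → ℂ) × ℝ → ℝ}
    (hW : WeightedDerivativesVanish m r) (hm : m ≠ 0) (hr : ContDiffAt ℝ ∞ r 0) :
    HasStrictFDerivAt r (0 : _ →L[ℝ] ℝ) 0 := by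
  have ho := isLittleO_of_isBigO_weightedModulus (hW.sub_isBigO hr) hW.apply_zero
  have hlin : (fun x : (Fin n → ℂ) × ℝ => ‖x.1‖ ^ m + ‖x.2‖) =O[𝓝 0] fun x => x := by
    refine .of_bound 2 ?_
    filter_upwards [Metric.closedBall_mem_nhds 0 one_pos] with x hx
    have hx1 : ‖x.1‖ ≤ 1 := (norm_fst_le x).trans (mem_closedBall_zero_iff.1 hx)
    have hpow : ‖x.1‖ ^ m ≤ ‖x.1‖ := pow_le_of_le_one (norm_nonneg _) hx1 hm
    rw [Real.norm_of_nonneg (by positivity)]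
    linarith [norm_fst_le x, norm_snd_le x]
  have h0 : HasFDerivAt r (0 : _ →L[ℝ] ℝ) 0 := by
    rw [hasFDerivAt_iff_isLittleO_nhds_zero]
    simpa [hW.apply_zero] using ho.trans_isBigO hlin
  exact hr.hasStrictFDerivAt' h0 (by simp)

variable {P : Fin k → MvPolynomial (Fin n) ℂ} {r : (Fin n → ℂ) × ℝ → ℝ}

lemma polyMap_zero (hd : d ≠ 0) (hP : ∀ l, (P l).IsHomogeneous d) : polyMap P 0 = 0 := by
  simpa [hd] using polyMap_smul hP 0 0

lemma perturbation_zero (hd : d ≠ 0) (hP : ∀ l, (P l).IsHomogeneous d)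
    (hW : WeightedDerivativesVanish m r) : sumOfSquares P (0 : (Fin n → ℂ) × ℝ).1 + r 0 = 0 := by
  simp [← norm_polyMap_sq, polyMap_zero hd hP, hW.apply_zero]

lemma hasStrictFDerivAt_perturbation (hd : d ≠ 0) (hP : ∀ l, (P l).IsHomogeneous d) (hm : m ≠ 0)
    (hr : ContDiffAt ℝ ∞ r 0) (hW : WeightedDerivativesVanish m r) :
    HasStrictFDerivAt (fun x => sumOfSquares P x.1 + r x) (0 : _ →L[ℝ] ℝ) 0 := by
  have hQ : HasStrictFDerivAt (sumOfSquares P) (0 : _ →L[ℝ] ℝ) (0 : (Fin n → ℂ) × ℝ).1 := by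
    refine ((contDiff_sumOfSquares P).contDiffAt.hasStrictFDerivAt (by simp)).congr_fderiv ?_
    ext ξ
    simp [fderiv_sumOfSquares, polyMap_zero hd hP]
  exact ((hQ.comp _ hasStrictFDerivAt_fst).add (hW.hasStrictFDerivAt_zero hm hr)).congr_fderiv
    (by simp)

theorem IsLocalAutomorphism.eventuallyEq_id (hd : d ≠ 0) (hP : ∀ l, (P l).IsHomogeneous d)
    (hQ : sumOfSquares P ≠ 0)
    (hnondeg : HolomorphicallyNondegenerateAt (modelDefiningFunction (sumOfSquares P)) 0)
    (hr : ContDiffAt ℝ ∞ r 0) (hW : WeightedDerivativesVanish (2 * d) r)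
    (hF : IsLocalAutomorphism (graph fun x => sumOfSquares P x.1 + r x) F)
    (hF3 : (fun p => F p - p) =O[𝓝 0] fun p => ‖p‖ ^ 3) : F =ᶠ[𝓝 0] id := by
  have hK : (fun p => F p - p) =ᶠ[𝓝 0] 0 :=
    eventually_eq_zero_of_preserves_graph hd (analyticOnNhd_polyMap P) (polyMap_smul hP)
      (polyMap_ne_zero hQ) (fun _ => eq_zero_of_annihilates hnondeg) hW.apply_zero
      (hW.sub_isBigO hr) (hF.1.sub analyticAt_id) hF3
      (by simpa only [norm_polyMap_sq, add_sub_cancel] using hF.2.2.2)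
  exact hK.mono fun p hp => sub_eq_zero.1 hp

end Automorphism

end CRModel

theorem theorem1p8 {n k d : ℕ} (hd : 1 ≤ d)
    (P : Fin k → MvPolynomial (Fin n) ℂ)
    (hP : ∀ l, (P l).IsHomogeneous d)
    (hQ : CRModel.sumOfSquares P ≠ 0)
    (hnondeg : CRModel.HolomorphicallyNondegenerateAt
      (CRModel.modelDefiningFunction (CRModel.sumOfSquares P)) 0)
    (M : Set (CRModel.Cn1 n))
    (hM : CRModel.IsSmoothPerturbation (2 * d) (CRModel.sumOfSquares P) M)
    (F G : CRModel.Cn1 n → CRModel.Cn1 n)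
    (hF : CRModel.IsLocalAutomorphism M F) (hG : CRModel.IsLocalAutomorphism M G)
    (hjet : CRModel.SameJet 2 F G 0) :
    F =ᶠ[𝓝 0] G := by
  open CRModel in
  have hd0 : d ≠ 0 := Nat.one_le_iff_ne_zero.1 hd
  obtain ⟨r, hr, hW, hMr⟩ := hM.exists_remainder (contDiff_sumOfSquares P)
  replace hF := hF.congr_set hMr
  replace hG := hG.congr_set hMr
  obtain ⟨F', hF', hF'F, hFF'⟩ := hF.exists_inverse
    (hasStrictFDerivAt_perturbation hd0 hP (mul_ne_zero two_ne_zero hd0) hr hW)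
    (perturbation_zero hd0 hP hW)
  have hjet' : (fun p => (F' ∘ G) p - p) =O[𝓝 0] fun p => ‖p‖ ^ 3 :=
    (comp_sub_self_isBigO_sub hF'.1 hF.tendsto hG.tendsto hF'F).trans (hjet.isBigO_sub hF.1 hG.1)
  have hid : F' ∘ G =ᶠ[𝓝 0] id :=
    (hF'.comp hG).eventuallyEq_id hd0 hP hQ hnondeg hr hW hjet'
  filter_upwards [hid, hG.tendsto.eventually hFF'] with p hp hGp
  exact (congrArg F hp).symm.trans hGp
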